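/- Let $(\mathsf B,\mathsf D,\rho,\nu)$ be a random compact pointed metric space endowed with a Borel probability measure $\nu$, and let $(\mathsf B_n,\mathsf D_n,\rho_n,\nu_n)_{n\ge1}$ be i.i.d. copies of it. Let $(\lambda_n)_{n\ge1}$ be deterministic positive real numbers and $(w_n)_{n\ge1}$ deterministic non-negative real numbers with $w_1>0$. Let $\mathbf b_n$ be the block $(\mathsf B_n,\lambda_n\mathsf D_n,\rho_n,w_n\nu_n)$, i.e. $\mathsf B_n$ with distances multiplied by $\lambda_n$ and measure multiplied by $w_n$. Set $\mathcal T_1=\mathbf b_1$; given $\mathcal T_n$, obtained by gluing $\mathbf b_1,\dots,\mathbf b_n$, form $\mathcal T_{n+1}$ by identifying the root of $\mathbf b_{n+1}$ with a random point $X_n\in\mathcal T_n$ chosen as follows: conditionally on all the blocks, and independently for different $n$, choose $K_n\in\{1,\dots,n\}$ with $\mathbb P(K_n=k)=w_k/(w_1+\dots+w_n)$, and then choose $X_n$ in the block $\mathbf b_{K_n}$ according to $\nu_{K_n}$. The distance on $\mathcal T_{n+1}$ is the usual glued one: it extends those of $\mathcal T_n$ and $\mathbf b_{n+1}$, and the distance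 from $x\in\mathcal T_n$ to $y\in\mathbf b_{n+1}$ is the distance from $x$ to $X_n$ plus the distance in $\mathbf b_{n+1}$ from the root to $y$. Let $\mathcal T^*=\bigcup_{n\ge1}\mathcal T_n$, let $\mathcal T$ be the completion of $\mathcal T^*$, and let $\mathcal L=\mathcal T\setminus\mathcal T^*$. Let $d\ge0$, $\alpha>0$ with $\alpha d<1$ (that is, $0<\alpha<1/d$, where $1/0=\infty$), and $\beta>1$. Assume that $\lambda_n\le n^{-\alpha+o(1)}$ and $w_n\le n^{-\beta+o(1)}$ as $n\to\infty$; that $\mathbb E[\operatorname{diam}(\mathsf B)^k]<\infty$ for every integer $k\ge0$; and that $\mathbb E[N_r(\mathsf B)]\le r^{-d+o(1)}$ as $r\to0$, where $N_r(\mathsf B)$ is the minimal number of open balls of radius $r$ needed to cover $\mathsf B$. Then, almost surely, the Hausdorff dimension of $\mathcal L$ satisfies $$\dim_{\mathrm H}(\mathcal L)\le\frac{2\beta-1-2\sqrt{(\beta-1)(\beta-\alpha d)}}{\alpha}.$$ -/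

import Mathlib

open MeasureTheory ProbabilityTheory TopologicalSpace Filter
open scoped ENNReal Topology

noncomputable section

namespace Gluing

variable {U : Type*} [MetricSpace U]

/-- A block: a compact pointed metric space with a Borel probability measure, realised inside an
ambient metric space `U` in such a way that its root is the distinguished point `u₀`. -/
structure Block [MeasurableSpace U] (u₀ : U) where
  /-- the underlying compact metric space, with the distance of `U` -/
  carrier : NonemptyCompacts U
  root_mem : u₀ ∈ carrier
  /-- the probability measure carried by the block -/
  mass : ProbabilityMeasure U
  mass_carrier : (mass : Measure U) (carrier : Set U) = 1

/-- The σ-algebra on blocks: the Borel σ-algebra of the Hausdorff distance for the compact set and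
the σ-algebra generated by the evaluations `ν ↦ ν A` for the measure. When `U` is Polish this is
the Borel σ-algebra of the Hausdorff-Prokhorov distance. -/
instance [MeasurableSpace U] (u₀ : U) : MeasurableSpace (Block u₀) :=
  (borel (NonemptyCompacts U)).comap Block.carrier ⊔ MeasurableSpace.comap Block.mass inferInstance

/-- The minimal number of open balls of radius `r`, centred in `S`, needed to cover `S`. -/
def ballNumber (r : ℝ) (S : Set U) : ℕ∞ :=
  ⨅ (C : Set U) (_ : C ⊆ S) (_ : S ⊆ ⋃ x ∈ C, Metric.ball x r), C.encard

/-- The sequences `x` of points of `U` with `∑ λ_n δ(x_n, u₀) < ∞`. The `n`-th coordinate is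
measured with the distance `λ_n · δ`, so that a block placed on the `n`-th coordinate is dilated by
the factor `λ_n`. Indices start at `0`. -/
def Space (u₀ : U) (lam : ℕ → ℝ) (_hlam : ∀ n, 0 < lam n) : Type _ :=
  {x : ℕ → U // Summable fun n => lam n * dist (x n) u₀}

section Space

variable {u₀ : U} {lam : ℕ → ℝ} {hlam : ∀ n, 0 < lam n}

theorem Space.summable_dist (x y : Space u₀ lam hlam) :
    Summable fun n => lam n * dist (x.1 n) (y.1 n) := by
  refine Summable.of_nonneg_of_le (fun n => mul_nonneg (hlam n).le dist_nonneg) (fun n => ?_)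
    (x.2.add y.2)
  rw [← mul_add]
  exact mul_le_mul_of_nonneg_left (dist_triangle_right _ _ _) (hlam n).le

/-- The distance `∑ λ_n δ(x_n, y_n)`. -/
instance : MetricSpace (Space u₀ lam hlam) where
  dist x y := ∑' n, lam n * dist (x.1 n) (y.1 n)
  dist_self x := by simp
  dist_comm x y := by simp only [dist_comm]
  dist_triangle x y z := by
    rw [← (Space.summable_dist x y).tsum_add (Space.summable_dist y z)]
    refine (Space.summable_dist x z).tsum_le_tsum (fun n => ?_)
      ((Space.summable_dist x y).add (Space.summable_dist y z))
    rw [← mul_add]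
    exact mul_le_mul_of_nonneg_left (dist_triangle _ _ _) (hlam n).le
  eq_of_dist_eq_zero := by
    intro x y h
    have h0 := (Space.summable_dist x y).hasSum_iff.2 h
    rw [hasSum_zero_iff_of_nonneg (fun n => mul_nonneg (hlam n).le dist_nonneg)] at h0
    refine Subtype.ext (funext fun n => ?_)
    have h1 := congrFun h0 n
    simpa [(hlam n).ne'] using h1

end Space

/-- The root of the `n`-th block inside the glued structure, as a sequence of points of `U`. The
root of block `0` is `(u₀, u₀, …)`. Block `n + 1` is grafted at the point `z n` of block `k n`, and
the point `x` of block `m` is the root of block `m` with its `m`-th coordinate replaced by `x`. -/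
def rootSeq (u₀ : U) (k : ∀ n : ℕ, Fin (n + 1)) (z : ℕ → U) : ℕ → (ℕ → U)
  | 0 => fun _ => u₀
  | n + 1 => Function.update (rootSeq u₀ k z (k n)) (k n) (z n)
termination_by n => n
decreasing_by exact (k n).isLt

/-- Only finitely many coordinates of a root differ from `u₀`. -/
theorem rootSeq_of_le {V : Type*} (u₀ : V) (k : ∀ n : ℕ, Fin (n + 1)) (z : ℕ → V) (n : ℕ) :
    ∀ m, n ≤ m → rootSeq u₀ k z n m = u₀ := by
  induction n using Nat.strong_induction_on with
  | _ n ih =>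
    intro m hm
    cases n with
    | zero => rw [rootSeq]
    | succ n =>
      have hk := (k n).isLt
      rw [rootSeq, Function.update_of_ne (by omega)]
      exact ih _ hk m (by omega)

/-- The point `x` of the `n`-th block, as a point of the glued structure. -/
def blockPoint (u₀ : U) (lam : ℕ → ℝ) (hlam : ∀ n, 0 < lam n) (k : ∀ n : ℕ, Fin (n + 1))
    (z : ℕ → U) (n : ℕ) (x : U) : Space u₀ lam hlam :=
  ⟨Function.update (rootSeq u₀ k z n) n x, by
    refine summable_of_ne_finset_zero (s := Finset.range (n + 1)) fun m hm => ?_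
    have hm' : n < m := by simpa using hm
    rw [Function.update_of_ne hm'.ne', rootSeq_of_le u₀ k z n m hm'.le]
    simp⟩

/-- The skeleton `𝒯*`: the union of all the glued blocks. -/
def skeleton {u₀ : U} [MeasurableSpace U] (lam : ℕ → ℝ) (hlam : ∀ n, 0 < lam n)
    (b : ℕ → Block u₀) (k : ∀ n : ℕ, Fin (n + 1)) (z : ℕ → U) : Set (Space u₀ lam hlam) :=
  ⋃ n, blockPoint u₀ lam hlam k z n '' ((b n).carrier : Set U)

/-- The set of leaves `ℒ = 𝒯 \ 𝒯*`, where `𝒯` is the closure of the skeleton `𝒯*` (its completion,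
when `U` is complete). -/
def leaves {u₀ : U} [MeasurableSpace U] (lam : ℕ → ℝ) (hlam : ∀ n, 0 < lam n)
    (b : ℕ → Block u₀) (k : ∀ n : ℕ, Fin (n + 1)) (z : ℕ → U) : Set (Space u₀ lam hlam) :=
  closure (skeleton lam hlam b k z) \ skeleton lam hlam b k z

/-- The law, given the blocks, of the place where block `n + 1` is grafted: among the blocks
`0, …, n`, block `j` is chosen with probability `w_j / (w_0 + ⋯ + w_n)`, and then a point of this
block is chosen according to its probability measure. -/
def graftLaw {u₀ : U} [MeasurableSpace U] (w : ℕ → ℝ) (b : ℕ → Block u₀) (n : ℕ) :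
    Measure (Fin (n + 1) × U) :=
  ∑ j : Fin (n + 1), ENNReal.ofReal (w j / ∑ i ∈ Finset.range (n + 1), w i) •
    (Measure.dirac j).prod ((b j).mass : Measure U)

/-- The random gluing procedure with weights `w`: the blocks `B n` are i.i.d. with law `τ`, and
conditionally on the whole sequence of blocks, the pairs `(K n, Z n)`, which say that block `n + 1`
is grafted at the point `Z n` of block `K n`, are independent with respective laws `graftLaw`. -/
structure IsRandomGluing {Ω : Type*} [MeasurableSpace Ω] (P : Measure Ω) {u₀ : U}
    [MeasurableSpace U] (τ : Measure (Block u₀)) (w : ℕ → ℝ)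
    (B : ℕ → Ω → Block u₀) (K : ∀ n : ℕ, Ω → Fin (n + 1)) (Z : ℕ → Ω → U) : Prop where
  measurable_block : ∀ n, Measurable (B n)
  measurable_index : ∀ n, Measurable (K n)
  measurable_point : ∀ n, Measurable (Z n)
  indep_block : iIndepFun B P
  law_block : ∀ n, P.map (B n) = τ
  cond_graft : ∀ (n : ℕ) (A : Set (ℕ → Block u₀)) (C : ∀ i : ℕ, Set (Fin (i + 1) × U)),
    MeasurableSet A → (∀ i, MeasurableSet (C i)) →
    P ({ω | (fun i => B i ω) ∈ A} ∩ {ω | ∀ i < n, (K i ω, Z i ω) ∈ C i}) =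
      ∫⁻ ω in {ω | (fun i => B i ω) ∈ A},
        ∏ i ∈ Finset.range n, graftLaw w (fun j => B j ω) i (C i) ∂P

end Gluing

end

noncomputable section

namespace Gluing

/-! ### Geometry of the glued space: descendants, heights of subtrees, coverings. -/

section Deterministic

variable {U : Type*} [MetricSpace U] {u₀ : U} {lam : ℕ → ℝ} {hlam : ∀ n, 0 < lam n}

/-! Fix `s` strictly between the claimed bound and `1 / α`, and ignore `o(1)` terms. The subtree of
block `m` (the block and all its descendants) has height of order `m ^ (-α)`, so a single ball
covers it at `s`-cost of order `m ^ (-(α * s))`. Suppose the expected cost is known to be at most of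
order `m ^ (-a)` with `a < 1`. A better covering cuts at a time `m ^ γ`, `γ > 1`. Balls of radius of
order `m ^ (-(γ * α))` cover the block together with every subtree grafted on it after that time;
about `m ^ ((γ - 1) * α * d)` of them suffice on average. The subtrees grafted earlier are covered
separately: each is grafted on block `m` with probability at most of order `m ^ (-β)`, so their
total cost is of order `m ^ (-β + γ * (1 - a))`. Equating both exponents determines `γ` and yields a
new exponent (`CostBound.improve`).

The gain in the exponent is a quadratic polynomial divided by a positive number, and for such `s`
the discriminant is negative (`discriminant_neg`). The gain is thus bounded below, and the exponent
eventually exceeds `1` (`exists_costBound`). The costs are then almost surely summable over `m`.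
Every leaf lies in the closure of subtrees of arbitrarily large index (`leaves_subset`), so the
`s`-dimensional Hausdorff measure of the leaves vanishes (`dimH_leaves_le`).

Heights are controlled because, almost surely, a fixed number of generations eventually doubles the
index (`IsRandomGluing.ae_doubling`, `Controlled.of_doubling`). Expectations factorise because the
cost of a subtree grafted at time `n` is dominated by a function of the blocks and of later choices,
which are independent of `K n` (`IsRandomGluing.lintegral_graftInd_mul_le`). -/

theorem dist_blockPoint (k : ∀ n : ℕ, Fin (n + 1)) (z : ℕ → U) (n : ℕ) (x y : U) :
    dist (blockPoint u₀ lam hlam k z n x) (blockPoint u₀ lam hlam k z n y) =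
      lam n * dist x y := by
  change ∑' m, lam m * dist (Function.update (rootSeq u₀ k z n) n x m)
    (Function.update (rootSeq u₀ k z n) n y m) = _
  rw [tsum_eq_single n]
  · simp
  · intro m hm
    simp [Function.update_of_ne hm]

/-- The root of block `n + 1` is the point of block `k n` on which it is grafted. -/
theorem blockPoint_succ_root (k : ∀ n : ℕ, Fin (n + 1)) (z : ℕ → U) (n : ℕ) :
    blockPoint u₀ lam hlam k z (n + 1) u₀ = blockPoint u₀ lam hlam k z (k n) (z n) := by
  refine Subtype.ext ?_
  change Function.update (rootSeq u₀ k z (n + 1)) (n + 1) u₀ =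
    Function.update (rootSeq u₀ k z (k n)) (k n) (z n)
  have h := rootSeq_of_le u₀ k z (n + 1) (n + 1) le_rfl
  have h2 : Function.update (rootSeq u₀ k z (n + 1)) (n + 1) u₀ = rootSeq u₀ k z (n + 1) := by
    simpa only [h] using Function.update_eq_self (n + 1) (rootSeq u₀ k z (n + 1))
  rw [h2, rootSeq]

/-- `IsDesc k j m i` says that block `i` is a descendant of block `m`, `j` generations below. -/
def IsDesc (k : ∀ n : ℕ, Fin (n + 1)) : ℕ → ℕ → ℕ → Prop
  | 0, m, i => m = i
  | j + 1, m, i => ∃ n, (k n : ℕ) = m ∧ IsDesc k j (n + 1) i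

theorem IsDesc.le {k : ∀ n : ℕ, Fin (n + 1)} {j m i : ℕ} (h : IsDesc k j m i) : m ≤ i := by
  induction j generalizing m with
  | zero => exact le_of_eq h
  | succ j ih =>
    obtain ⟨n, rfl, h⟩ := h
    have := ih h
    have := (k n).isLt
    omega

theorem isDesc_add {k : ∀ n : ℕ, Fin (n + 1)} {a b m i : ℕ} :
    IsDesc k (a + b) m i ↔ ∃ m', IsDesc k a m m' ∧ IsDesc k b m' i := by
  induction a generalizing m with
  | zero => simp [IsDesc]
  | succ a ih =>
    rw [Nat.add_right_comm]
    simp only [IsDesc, ih]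
    constructor
    · rintro ⟨n, hn, m', h1, h2⟩
      exact ⟨m', ⟨n, hn, h1⟩, h2⟩
    · rintro ⟨m', ⟨n, hn, h1⟩, h2⟩
      exact ⟨n, hn, m', h1, h2⟩

variable [MeasurableSpace U]

variable (lam hlam) in
/-- The union of block `m` and all its descendants. -/
def subtree (b : ℕ → Block u₀) (k : ∀ n : ℕ, Fin (n + 1)) (z : ℕ → U) (m : ℕ) :
    Set (Space u₀ lam hlam) :=
  ⋃ (i) (_ : ∃ j, IsDesc k j m i), blockPoint u₀ lam hlam k z i '' ((b i).carrier : Set U)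

variable {b : ℕ → Block u₀} {k : ∀ n : ℕ, Fin (n + 1)} {z : ℕ → U}

theorem subtree_subset (m : ℕ) :
    subtree lam hlam b k z m ⊆ blockPoint u₀ lam hlam k z m '' ((b m).carrier : Set U) ∪
      ⋃ (n) (_ : (k n : ℕ) = m), subtree lam hlam b k z (n + 1) := by
  intro p hp
  simp only [subtree, Set.mem_iUnion] at hp
  obtain ⟨i, ⟨j, hj⟩, hp⟩ := hp
  cases j with
  | zero =>
    cases (show m = i from hj)
    exact Or.inl hp
  | succ j =>
    obtain ⟨n, hn, hj⟩ := hj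
    refine Or.inr ?_
    simp only [subtree, Set.mem_iUnion]
    exact ⟨n, hn, i, ⟨j, hj⟩, hp⟩

/-- Go up the ancestral line of `i` until the parent has index below `N`; this happens because the
line ends at block `0`. -/
theorem exists_isDesc_of_parent_lt (k : ∀ n : ℕ, Fin (n + 1)) {N : ℕ} (hN : 1 ≤ N) (i : ℕ) :
    i < N ∨ ∃ n, N ≤ n + 1 ∧ (k n : ℕ) < N ∧ ∃ j, IsDesc k j (n + 1) i := by
  induction i using Nat.strong_induction_on with
  | _ i ih =>
    by_cases hi : i < N
    · exact Or.inl hi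
    right
    obtain ⟨n, rfl⟩ : ∃ n, i = n + 1 := ⟨i - 1, by omega⟩
    rcases ih (k n) (k n).isLt with h | ⟨n', h1, h2, j, h3⟩
    · exact ⟨n, by omega, h, 0, rfl⟩
    · exact ⟨n', h1, h2, j + 1, isDesc_add.2 ⟨k n, h3, n, rfl, rfl⟩⟩

variable (lam hlam b k z) in
/-- From index `n₀` on, the subtree of block `m` has height at most `A * m ^ (-α)`, and all blocks
are grafted on points of the blocks. -/
structure Controlled (α A : ℝ) (n₀ : ℕ) : Prop where
  one_le : 1 ≤ n₀
  graft_mem : ∀ n, z n ∈ ((b (k n)).carrier : Set U)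
  subtree_subset : ∀ m, n₀ ≤ m → subtree lam hlam b k z m ⊆
    Metric.closedBall (blockPoint u₀ lam hlam k z m u₀) (A * (m : ℝ) ^ (-α))

/-- A leaf is at positive distance from the compact union of the first `N` blocks. Subtrees grafted
late on this union are too short to come near the leaf, so finitely many subtrees remain, and
closure commutes with their union. -/
theorem leaves_subset {α A : ℝ} {n₀ N : ℕ} (hα : 0 < α)
    (h : Controlled lam hlam b k z α A n₀) (hN : n₀ ≤ N) :
    leaves lam hlam b k z ⊆ ⋃ (m) (_ : N ≤ m), closure (subtree lam hlam b k z m) := by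
  rintro x ⟨hx, hx'⟩
  have hN1 := h.one_le.trans hN
  set S : Set (Space u₀ lam hlam) := ⋃ i ∈ Finset.range N,
    blockPoint u₀ lam hlam k z i '' ((b i).carrier : Set U) with hS
  have hcont : ∀ i, Continuous (blockPoint u₀ lam hlam k z i) := fun i =>
    (LipschitzWith.of_dist_le_mul (K := (lam i).toNNReal) fun x y => by
      rw [dist_blockPoint, Real.coe_toNNReal _ (hlam i).le]).continuous
  have hScl : IsClosed S := by
    refine Set.Finite.isClosed_biUnion (Finset.finite_toSet _) fun i _ => ?_
    exact ((b i).carrier.isCompact.image (hcont i)).isClosed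
  have hxS : x ∉ S := fun hxS => hx' <| by
    simp only [hS, Set.mem_iUnion] at hxS
    obtain ⟨i, -, hi⟩ := hxS
    exact Set.mem_iUnion.2 ⟨i, hi⟩
  obtain ⟨η, hη, hball⟩ := Metric.isOpen_iff.1 hScl.isOpen_compl x hxS
  have hlim : Tendsto (fun m : ℕ => A * (m : ℝ) ^ (-α)) atTop (𝓝 0) := by
    simpa using ((tendsto_rpow_neg_atTop hα).comp tendsto_natCast_atTop_atTop).const_mul A
  obtain ⟨M, hM⟩ := eventually_atTop.1 (hlim.eventually (gt_mem_nhds (half_pos hη)))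
  set T : Set (Space u₀ lam hlam) := ⋃ m ∈ Finset.Ico N M, subtree lam hlam b k z m with hT
  have hcov : skeleton lam hlam b k z ⊆ (Metric.ball x (η / 2))ᶜ ∪ T := by
    intro p hp
    by_cases hpx : p ∈ Metric.ball x (η / 2)
    swap
    · exact Or.inl hpx
    right
    obtain ⟨i, hi⟩ := Set.mem_iUnion.1 hp
    have hpS : p ∉ S := hball (Metric.ball_subset_ball (half_le_self hη.le) hpx)
    rcases exists_isDesc_of_parent_lt k hN1 i with hiN | ⟨n, hn, hkn, j, hj⟩
    · exact absurd (Set.mem_biUnion (Finset.mem_coe.2 (Finset.mem_range.2 hiN)) hi) hpS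
    have hps : p ∈ subtree lam hlam b k z (n + 1) :=
      Set.mem_iUnion₂.2 ⟨i, ⟨j, hj⟩, hi⟩
    refine Set.mem_biUnion (Finset.mem_coe.2 (Finset.mem_Ico.2 ⟨hn, ?_⟩)) hps
    by_contra hnM
    have h1 := h.subtree_subset (n + 1) (hN.trans hn) hps
    have h2 := hM (n + 1) (by omega)
    have h3 : blockPoint u₀ lam hlam k z (n + 1) u₀ ∈ S := by
      rw [blockPoint_succ_root]
      exact Set.mem_biUnion (Finset.mem_coe.2 (Finset.mem_range.2 hkn))
        (Set.mem_image_of_mem _ (h.graft_mem n))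
    refine hball ?_ h3
    rw [Metric.mem_closedBall] at h1
    rw [Metric.mem_ball] at hpx ⊢
    have := dist_triangle_left (blockPoint u₀ lam hlam k z (n + 1) u₀) x p
    linarith
  have hx2 := closure_mono hcov hx
  rw [closure_union] at hx2
  rcases hx2 with hx2 | hx2
  · rw [Metric.isOpen_ball.isClosed_compl.closure_eq] at hx2
    exact absurd (Metric.mem_ball_self (half_pos hη)) hx2
  · rw [hT, Finset.closure_biUnion] at hx2
    obtain ⟨m, hm, hxm⟩ := Set.mem_iUnion₂.1 hx2
    exact Set.mem_iUnion₂.2 ⟨m, (Finset.mem_Ico.1 hm).1, hxm⟩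

theorem dist_blockPoint_le (i : ℕ) {x y : U} (hx : x ∈ ((b i).carrier : Set U))
    (hy : y ∈ ((b i).carrier : Set U)) :
    dist (blockPoint u₀ lam hlam k z i x) (blockPoint u₀ lam hlam k z i y) ≤
      lam i * Metric.diam ((b i).carrier : Set U) := by
  rw [dist_blockPoint]
  exact mul_le_mul_of_nonneg_left
    (Metric.dist_le_diam_of_mem (b i).carrier.isCompact.isBounded hx hy) (hlam i).le

/-- Each run of `l` generations has length at most `l * m ^ (-α)` and at least doubles the index, so
heights are bounded by a geometric series of ratio `2 ^ (-α)`, whose sum is the constant. -/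
theorem Controlled.of_doubling {α : ℝ} (hα : 0 < α) {n₀ l : ℕ} (hn₀ : 1 ≤ n₀) (hl : 1 ≤ l)
    (hz : ∀ n, z n ∈ ((b (k n)).carrier : Set U))
    (hdiam : ∀ n, n₀ ≤ n → lam n * Metric.diam ((b n).carrier : Set U) ≤ (n : ℝ) ^ (-α))
    (hdesc : ∀ n, n₀ ≤ n → ∀ i, IsDesc k l n i → 2 * n ≤ i) :
    Controlled lam hlam b k z α (l / (1 - 2 ^ (-α))) n₀ := by
  set A : ℝ := l / (1 - 2 ^ (-α)) with hA
  have h2 : (2 : ℝ) ^ (-α) < 1 := Real.rpow_lt_one_of_one_lt_of_neg (by norm_num) (by linarith)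
  have h2' : (0 : ℝ) < 2 ^ (-α) := by positivity
  have hAl : A = l + A * 2 ^ (-α) := by
    have : (1 : ℝ) - 2 ^ (-α) ≠ 0 := by linarith
    rw [hA]; field_simp; ring
  have hA0 : 0 ≤ A := div_nonneg (Nat.cast_nonneg _) (by linarith)
  have hanti : ∀ {m i : ℕ}, n₀ ≤ m → m ≤ i → (i : ℝ) ^ (-α) ≤ (m : ℝ) ^ (-α) := by
    intro m i hm hmi
    have : 0 < m := by omega
    exact Real.rpow_le_rpow_of_nonpos (by exact_mod_cast this) (by exact_mod_cast hmi)
      (by linarith)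
  have hroot : ∀ j m i, n₀ ≤ m → IsDesc k j m i →
      dist (blockPoint u₀ lam hlam k z i u₀) (blockPoint u₀ lam hlam k z m u₀) ≤
        j * (m : ℝ) ^ (-α) := by
    intro j
    induction j with
    | zero =>
      intro m i _ h
      cases (show m = i from h)
      simp
    | succ j ih =>
      rintro m i hm ⟨n, rfl, h⟩
      have hkn := (k n).isLt
      have h1 := ih (n + 1) i (by omega) h
      have h2 := hanti hm hkn.le
      have h3 := (dist_blockPoint_le (lam := lam) (hlam := hlam) (k := k) (z := z) (k n) (hz n)
        (b (k n)).root_mem).trans (hdiam _ hm)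
      rw [← blockPoint_succ_root] at h3
      have h4 := mul_le_mul_of_nonneg_left h2 (Nat.cast_nonneg (α := ℝ) j)
      have h5 := dist_triangle (blockPoint u₀ lam hlam k z i u₀)
        (blockPoint u₀ lam hlam k z (n + 1) u₀) (blockPoint u₀ lam hlam k z (k n) u₀)
      push_cast at *
      linarith
  -- Strong induction on the number of generations, removing `l` of them at a time; `hAl` closes the
  -- recursion.
  have key : ∀ j m i, n₀ ≤ m → IsDesc k j m i → ∀ x ∈ ((b i).carrier : Set U),
      dist (blockPoint u₀ lam hlam k z i x) (blockPoint u₀ lam hlam k z m u₀) ≤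
        A * (m : ℝ) ^ (-α) := by
    intro j
    induction j using Nat.strong_induction_on with
    | _ j ih =>
      intro m i hm hj x hx
      have hm0 : 0 ≤ (m : ℝ) ^ (-α) := by positivity
      by_cases hjl : j < l
      · have h1 := hroot j m i hm hj
        have h2 := (dist_blockPoint_le (lam := lam) (hlam := hlam) (k := k) (z := z) i hx
          (b i).root_mem).trans ((hdiam _ (hm.trans hj.le)).trans (hanti hm hj.le))
        have h3 := dist_triangle (blockPoint u₀ lam hlam k z i x)
          (blockPoint u₀ lam hlam k z i u₀) (blockPoint u₀ lam hlam k z m u₀)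
        have h4 : (j : ℝ) + 1 ≤ l := by exact_mod_cast hjl
        have h5 : (j : ℝ) + 1 ≤ A := by
          rw [hAl]
          have := mul_nonneg hA0 h2'.le
          linarith
        nlinarith
      · obtain ⟨a, rfl⟩ : ∃ a, j = l + a := ⟨j - l, by omega⟩
        obtain ⟨m', hm', ha⟩ := isDesc_add.1 hj
        have h1 := hroot l m m' hm hm'
        have h6 := hdesc m hm m' hm'
        have h2 := ih a (by omega) m' i (by omega) ha x hx
        have h7 : (m' : ℝ) ^ (-α) ≤ 2 ^ (-α) * (m : ℝ) ^ (-α) := by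
          have := hanti (m := 2 * m) (by omega) h6
          rwa [Nat.cast_mul, Real.mul_rpow (by positivity) (by positivity), Nat.cast_ofNat] at this
        have h3 := dist_triangle (blockPoint u₀ lam hlam k z i x)
          (blockPoint u₀ lam hlam k z m' u₀) (blockPoint u₀ lam hlam k z m u₀)
        have h8 := mul_le_mul_of_nonneg_left h7 hA0
        calc _ ≤ _ := h3
          _ ≤ A * (2 ^ (-α) * (m : ℝ) ^ (-α)) + l * (m : ℝ) ^ (-α) := by linarith
          _ = (l + A * 2 ^ (-α)) * (m : ℝ) ^ (-α) := by ring
          _ = A * (m : ℝ) ^ (-α) := by rw [← hAl]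
  refine ⟨hn₀, hz, fun m hm p hp => ?_⟩
  simp only [subtree, Set.mem_iUnion] at hp
  obtain ⟨i, ⟨j, hj⟩, x, hx, rfl⟩ := hp
  exact key j m i hm hj x hx

/-- The size-`δ` approximation of the `s`-dimensional Hausdorff measure. -/
def hausdorffPre {X : Type*} [MetricSpace X] (s : ℝ) (δ : ℝ≥0∞) : OuterMeasure X :=
  OuterMeasure.mkMetric'.pre (fun S => Metric.ediam S ^ s) δ

theorem hausdorffPre_closedBall_le {X : Type*} [MetricSpace X] {s : ℝ} (hs : 0 ≤ s) {δ : ℝ≥0∞}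
    (x : X) {R : ℝ} (hR : ENNReal.ofReal (2 * R) ≤ δ) :
    hausdorffPre s δ (Metric.closedBall x R) ≤ ENNReal.ofReal (2 * R) ^ s := by
  have h : Metric.ediam (Metric.closedBall x R) ≤ ENNReal.ofReal (2 * R) := by
    refine Metric.ediam_le fun y hy z hz => ?_
    rw [edist_dist]
    refine ENNReal.ofReal_le_ofReal ?_
    have := dist_triangle_right y z x
    rw [Metric.mem_closedBall] at hy hz
    linarith
  exact (OuterMeasure.mkMetric'.pre_le (h.trans hR)).trans (ENNReal.rpow_le_rpow h hs)

/-- A finite infimum in `ℕ∞` is attained; if it is infinite, `S` itself serves as the set of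
centres. -/
theorem exists_cover_encard_le {V : Type*} [MetricSpace V] {r : ℝ} (hr : 0 < r) (S : Set V) :
    ∃ C : Set V, C ⊆ S ∧ (S ⊆ ⋃ x ∈ C, Metric.ball x r) ∧ C.encard ≤ ballNumber r S := by
  by_cases h : ballNumber r S = ⊤
  · exact ⟨S, le_rfl, fun x hx => Set.mem_biUnion hx (Metric.mem_ball_self hr), h ▸ le_top⟩
  have h1 : ballNumber r S < ballNumber r S + 1 := (ENat.lt_add_one_iff h).2 le_rfl
  conv_lhs at h1 => rw [ballNumber]
  simp only [iInf_lt_iff] at h1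
  obtain ⟨C, hC, hC', h2⟩ := h1
  exact ⟨C, hC, hC', (ENat.lt_add_one_iff h).1 h2⟩

theorem hausdorffPre_le_encard_mul {X : Type*} [MetricSpace X] {s : ℝ} (hs : 0 ≤ s) {δ : ℝ≥0∞}
    {V : Type*} {C : Set V} (f : V → X) {R : ℝ} (hR : 0 < R) (hRδ : ENNReal.ofReal (2 * R) ≤ δ)
    {S : Set X} (hS : S ⊆ ⋃ x ∈ C, Metric.closedBall (f x) R) :
    hausdorffPre s δ (closure S) ≤ ((C.encard : ℕ∞) : ℝ≥0∞) * ENNReal.ofReal (2 * R) ^ s := by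
  rcases C.finite_or_infinite with hfin | hinf
  · have hcl : closure S ⊆ ⋃ x ∈ C, Metric.closedBall (f x) R :=
      closure_minimal hS (hfin.isClosed_biUnion fun _ _ => Metric.isClosed_closedBall)
    lift C to Finset V using hfin
    calc hausdorffPre s δ (closure S) ≤ hausdorffPre s δ (⋃ x ∈ C, Metric.closedBall (f x) R) :=
          measure_mono hcl
      _ ≤ ∑ x ∈ C, hausdorffPre s δ (Metric.closedBall (f x) R) := measure_biUnion_finset_le _ _
      _ ≤ ∑ x ∈ C, ENNReal.ofReal (2 * R) ^ s :=
          Finset.sum_le_sum fun x _ => hausdorffPre_closedBall_le hs _ hRδ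
      _ = _ := by simp [Set.encard_coe_eq_coe_finsetCard]
  -- With infinitely many centres the right-hand side is `∞`, the radius being positive.
  · rw [hinf.encard_eq, ENat.toENNReal_top, ENNReal.top_mul]
    · exact le_top
    · exact (ENNReal.rpow_pos (by simpa using hR) ENNReal.ofReal_ne_top).ne'

/-- Covering of a subtree: the block at its root together with the subtrees grafted on it after
time `Y` is covered by few balls, and each subtree grafted before time `Y` is covered
separately. -/
theorem hausdorffPre_subtree_le {α A s : ℝ} {n₀ m Y : ℕ} {y r : ℝ} {δ : ℝ≥0∞} (hα : 0 < α)
    (hA : 0 ≤ A) (hs : 0 ≤ s)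
    (h : Controlled lam hlam b k z α A n₀) (hm : n₀ ≤ m) (hr : 0 < r) (hy : 0 < y)
    (hyY : y ≤ Y + 1) (hlr : lam m * r ≤ y ^ (-α))
    (hδ : ENNReal.ofReal (2 * ((1 + A) * y ^ (-α))) ≤ δ) :
    hausdorffPre s δ (closure (subtree lam hlam b k z m)) ≤
      ((ballNumber r ((b m).carrier : Set U) : ℕ∞) : ℝ≥0∞) *
        ENNReal.ofReal (2 * ((1 + A) * y ^ (-α))) ^ s +
      ∑ n ∈ Finset.Ico m Y, Set.indicator {n : ℕ | (k n : ℕ) = m}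
        (fun n => hausdorffPre s δ (closure (subtree lam hlam b k z (n + 1)))) n := by
  classical
  set D := (Finset.Ico m Y).filter fun n => (k n : ℕ) = m with hD
  -- Late subtrees are covered together with the block: each has its root on the block, hence near a
  -- centre, and its height is at most `A * y ^ (-α)`.
  set S := blockPoint u₀ lam hlam k z m '' ((b m).carrier : Set U) ∪
    ⋃ (n) (_ : (k n : ℕ) = m ∧ Y ≤ n), subtree lam hlam b k z (n + 1) with hS
  have hsub : subtree lam hlam b k z m ⊆ S ∪ ⋃ n ∈ D, subtree lam hlam b k z (n + 1) := by
    refine (subtree_subset m).trans (Set.union_subset ?_ ?_)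
    · exact Set.subset_union_left.trans Set.subset_union_left
    · refine Set.iUnion₂_subset fun n hn => ?_
      rcases le_or_gt Y n with hY | hY
      · refine Set.Subset.trans ?_ (Set.subset_union_left.trans' Set.subset_union_right)
        exact Set.subset_iUnion₂_of_subset n ⟨hn, hY⟩ le_rfl
      · refine Set.Subset.trans ?_ Set.subset_union_right
        have := (k n).isLt
        exact Set.subset_iUnion₂_of_subset n (by simp [hD]; omega) le_rfl
  have hcl := closure_mono hsub
  rw [closure_union, Finset.closure_biUnion] at hcl
  refine (measure_mono hcl).trans ((measure_union_le _ _).trans (add_le_add ?_ ?_))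
  · obtain ⟨C, hC, hcov, hcard⟩ := exists_cover_encard_le hr ((b m).carrier : Set U)
    have hyα : 0 < y ^ (-α) := by positivity
    refine (hausdorffPre_le_encard_mul hs (C := C) (blockPoint u₀ lam hlam k z m)
      (R := (1 + A) * y ^ (-α)) (by positivity) hδ ?_).trans
      (mul_le_mul_left (ENat.toENNReal_le.2 hcard) _)
    have hnear : ∀ x ∈ ((b m).carrier : Set U), ∃ c ∈ C,
        dist (blockPoint u₀ lam hlam k z m x) (blockPoint u₀ lam hlam k z m c) ≤ y ^ (-α) := by
      intro x hx
      obtain ⟨c, hc, hxc⟩ := Set.mem_iUnion₂.1 (hcov hx)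
      refine ⟨c, hc, ?_⟩
      rw [dist_blockPoint]
      exact (mul_le_mul_of_nonneg_left (Metric.mem_ball.1 hxc).le (hlam m).le).trans hlr
    refine Set.union_subset ?_ (Set.iUnion₂_subset fun n hn => ?_)
    · rintro _ ⟨x, hx, rfl⟩
      obtain ⟨c, hc, hxc⟩ := hnear x hx
      refine Set.mem_biUnion hc (Metric.mem_closedBall.2 ?_)
      nlinarith
    · obtain ⟨rfl, hnY⟩ := hn
      intro p hp
      have hkn := (k n).isLt
      have h1 := h.subtree_subset (n + 1) (by omega) hp
      obtain ⟨c, hc, hxc⟩ := hnear (z n) (h.graft_mem n)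
      rw [← blockPoint_succ_root] at hxc
      refine Set.mem_biUnion hc (Metric.mem_closedBall.2 ?_)
      rw [Metric.mem_closedBall] at h1
      -- The subtree grafted at time `n` has index `n + 1 ≥ Y + 1 ≥ y`, so `Y` may be the integer
      -- part of `y`.
      have h2 : ((n + 1 : ℕ) : ℝ) ^ (-α) ≤ y ^ (-α) :=
        Real.rpow_le_rpow_of_nonpos hy
          (hyY.trans (by exact_mod_cast Nat.succ_le_succ hnY)) (by linarith)
      have h3 := mul_le_mul_of_nonneg_left h2 hA
      have := dist_triangle p (blockPoint u₀ lam hlam k z (n + 1) u₀)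
        (blockPoint u₀ lam hlam k z (k n) c)
      linarith
  · refine (measure_biUnion_finset_le _ _).trans (le_of_eq ?_)
    rw [hD, Finset.sum_filter]
    exact Finset.sum_congr rfl fun n _ => by simp [Set.indicator_apply]

end Deterministic

/-! ### Measurability of covering numbers and diameters, by semicontinuity for the Hausdorff
distance. -/

section Measurability

variable {U : Type*} [MetricSpace U]

theorem exists_dist_lt_of_nonemptyCompacts {S T : NonemptyCompacts U} {ε : ℝ} (h : dist T S < ε)
    {x : U} (hx : x ∈ (S : Set U)) : ∃ y ∈ (T : Set U), dist x y < ε := by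
  rw [dist_comm, Metric.NonemptyCompacts.dist_eq] at h
  exact Metric.exists_dist_lt_of_hausdorffDist_lt hx h
    (Metric.hausdorffEDist_ne_top_of_nonempty_of_bounded S.nonempty T.nonempty
      S.isCompact.isBounded T.isCompact.isBounded)

/-- By compactness the same centres still cover `S` with a slightly smaller radius. The slack pays
for moving the centres into `T` and the points of `T` to `S`. -/
theorem eventually_ballNumber_le {r : ℝ} (hr : 0 < r) (S : NonemptyCompacts U) :
    ∀ᶠ T : NonemptyCompacts U in 𝓝 S,
      ballNumber r (T : Set U) ≤ ballNumber r (S : Set U) := by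
  obtain ⟨C, hCS, hcov, hcard⟩ := exists_cover_encard_le hr (S : Set U)
  obtain ⟨n, hn⟩ : ∃ n : ℕ, (S : Set U) ⊆ ⋃ x ∈ C, Metric.ball x (r - 1 / ((n : ℝ) + 1)) := by
    refine S.isCompact.elim_directed_cover
      (fun n : ℕ => ⋃ x ∈ C, Metric.ball x (r - 1 / ((n : ℝ) + 1)))
      (fun n => isOpen_biUnion fun _ _ => Metric.isOpen_ball) ?_ ?_
    · intro p hp
      obtain ⟨x, hx, hpx⟩ := Set.mem_iUnion₂.1 (hcov hp)
      rw [Metric.mem_ball] at hpx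
      obtain ⟨n, hn⟩ := exists_nat_one_div_lt (sub_pos.2 hpx)
      refine Set.mem_iUnion.2 ⟨n, Set.mem_biUnion hx ?_⟩
      rw [Metric.mem_ball]
      linarith
    · refine Monotone.directed_le fun m n hmn => Set.iUnion₂_mono fun x _ =>
        Metric.ball_subset_ball ?_
      have : 1 / ((n : ℝ) + 1) ≤ 1 / ((m : ℝ) + 1) := Nat.one_div_le_one_div hmn
      linarith
  set ε : ℝ := 1 / ((n : ℝ) + 1) with hε
  have hε0 : 0 < ε := Nat.one_div_pos_of_nat
  filter_upwards [Metric.ball_mem_nhds S (half_pos hε0)] with T hT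
  rw [Metric.mem_ball] at hT
  choose! g hgT hg using fun x (hx : x ∈ (S : Set U)) => exists_dist_lt_of_nonemptyCompacts hT hx
  refine le_trans ?_ ((Set.encard_image_le g C).trans hcard)
  refine iInf₂_le_of_le (g '' C) ?_ (iInf_le_of_le ?_ le_rfl)
  · rintro _ ⟨x, hx, rfl⟩
    exact hgT x (hCS hx)
  · intro p hp
    obtain ⟨q, hq, hpq⟩ := exists_dist_lt_of_nonemptyCompacts ((dist_comm S T).trans_lt hT) hp
    obtain ⟨x, hx, hqx⟩ := Set.mem_iUnion₂.1 (hn hq)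
    rw [Metric.mem_ball] at hqx
    refine Set.mem_biUnion (Set.mem_image_of_mem g hx) ?_
    rw [Metric.mem_ball]
    have h1 := hg x (hCS hx)
    have h2 := dist_triangle4 p q x (g x)
    linarith

theorem lowerSemicontinuous_diam :
    LowerSemicontinuous fun S : NonemptyCompacts U => Metric.diam (S : Set U) := by
  intro S a ha
  rcases lt_or_ge a 0 with ha0 | ha0
  · exact Eventually.of_forall fun T => ha0.trans_le Metric.diam_nonneg
  obtain ⟨x, hx, y, hy, hxy⟩ : ∃ x ∈ (S : Set U), ∃ y ∈ (S : Set U), a < dist x y := by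
    by_contra! hcon
    exact absurd (Metric.diam_le_of_forall_dist_le ha0 fun x hx y hy => hcon x hx y hy) ha.not_ge
  filter_upwards [Metric.ball_mem_nhds S (half_pos (sub_pos.2 hxy))] with T hT
  obtain ⟨x', hx', h1⟩ := exists_dist_lt_of_nonemptyCompacts hT hx
  obtain ⟨y', hy', h2⟩ := exists_dist_lt_of_nonemptyCompacts hT hy
  have h3 := Metric.dist_le_diam_of_mem T.isCompact.isBounded hx' hy'
  have h4 := dist_triangle4 x x' y' y
  rw [dist_comm y' y] at h4
  linarith

variable [MeasurableSpace U] {u₀ : U}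

theorem measurable_comp_carrier {X : Type*} [MeasurableSpace X] {f : NonemptyCompacts U → X}
    (hf : Measurable[borel (NonemptyCompacts U)] f) :
    Measurable fun b : Block u₀ => f b.carrier := by
  have h : @Measurable _ _ _ (borel (NonemptyCompacts U)) (Block.carrier (u₀ := u₀)) :=
    Measurable.of_comap_le le_sup_left
  exact hf.comp h

theorem measurable_ballNumber {r : ℝ} (hr : 0 < r) : Measurable fun b : Block u₀ =>
    ((ballNumber r (b.carrier : Set U) : ℕ∞) : ℝ≥0∞) := by
  have h : Measurable[borel (NonemptyCompacts U)] fun S : NonemptyCompacts U =>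
      ((ballNumber r (S : Set U) : ℕ∞) : ℝ≥0∞) := by
    borelize (NonemptyCompacts U)
    refine measurable_of_Iio fun a => IsOpen.measurableSet (isOpen_iff_mem_nhds.2 fun S hS => ?_)
    filter_upwards [eventually_ballNumber_le hr S] with T hT
    exact (ENat.toENNReal_le.2 hT).trans_lt hS
  exact measurable_comp_carrier h

theorem measurable_diam : Measurable fun b : Block u₀ => Metric.diam (b.carrier : Set U) := by
  have h : Measurable[borel (NonemptyCompacts U)] fun S : NonemptyCompacts U =>
      Metric.diam (S : Set U) := by
    borelize (NonemptyCompacts U)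
    exact measurable_of_Ioi fun a =>
      IsOpen.measurableSet (lowerSemicontinuous_diam.isOpen_preimage a)
  exact measurable_comp_carrier h

theorem measurableSet_disjoint_carrier {O : Set U} (hO : IsOpen O) :
    MeasurableSet {b : Block u₀ | ¬ ((b.carrier : Set U) ∩ O).Nonempty} := by
  have h : Measurable[borel (NonemptyCompacts U)] fun S : NonemptyCompacts U =>
      ((S : Set U) ∩ O).Nonempty := by
    borelize (NonemptyCompacts U)
    exact measurableSet_setOfPred.1
      (NonemptyCompacts.isOpen_inter_nonempty_of_isOpen hO).measurableSet
  exact measurableSet_setOfPred.2 (measurable_comp_carrier h).not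

end Measurability

/-! ### Independence of the blocks and of the chosen indices. -/

section Independence

/-- The law of the index of the block on which block `n + 1` is grafted. -/
def pickLaw (w : ℕ → ℝ) (n : ℕ) : Measure (Fin (n + 1)) :=
  ∑ j : Fin (n + 1), ENNReal.ofReal (w j / ∑ i ∈ Finset.range (n + 1), w i) • Measure.dirac j

theorem pickLaw_univ {w : ℕ → ℝ} (hw : ∀ n, 0 ≤ w n) (hw₀ : 0 < w 0) (n : ℕ) :
    pickLaw w n Set.univ = 1 := by
  have hpos : 0 < ∑ i ∈ Finset.range (n + 1), w i :=
    Finset.sum_pos' (fun i _ => hw i) ⟨0, by simp, hw₀⟩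
  simp only [pickLaw, Measure.finsetSum_apply, Measure.smul_apply, measure_univ, smul_eq_mul,
    mul_one]
  rw [← ENNReal.ofReal_sum_of_nonneg fun i _ => div_nonneg (hw _) hpos.le, ← Finset.sum_div,
    Fin.sum_univ_eq_sum_range (fun i => w i), div_self hpos.ne', ENNReal.ofReal_one]

/-- Bounding the normalising sum below by its first term loses only a constant factor when the
weights are summable. -/
theorem pickLaw_le {w : ℕ → ℝ} (hw : ∀ n, 0 ≤ w n) (hw₀ : 0 < w 0) (n m : ℕ) :
    pickLaw w n {j | (j : ℕ) = m} ≤ ENNReal.ofReal (w m / w 0) := by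
  have hle : w 0 ≤ ∑ i ∈ Finset.range (n + 1), w i :=
    Finset.single_le_sum (f := w) (fun i _ => hw i) (by simp)
  simp only [pickLaw, Measure.finsetSum_apply, Measure.smul_apply, smul_eq_mul]
  by_cases hm : m < n + 1
  · rw [Finset.sum_eq_single (⟨m, hm⟩ : Fin (n + 1))]
    · refine (mul_le_of_le_one_right' prob_le_one).trans (ENNReal.ofReal_le_ofReal ?_)
      exact div_le_div_of_nonneg_left (hw m) hw₀ hle
    · intro j _ hj
      rw [Measure.dirac_apply' _ (MeasurableSet.of_discrete)]
      have : (j : ℕ) ≠ m := fun h => hj (Fin.ext h)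
      simp [this]
    · simp
  · refine (Finset.sum_eq_zero fun j _ => ?_).trans_le zero_le
    rw [Measure.dirac_apply' _ (MeasurableSet.of_discrete)]
    have : (j : ℕ) ≠ m := by have := j.isLt; omega
    simp [this]

variable {Ω : Type*} {U : Type*} [MetricSpace U] [MeasurableSpace U] {u₀ : U}
  {B : ℕ → Ω → Block u₀} {K : ∀ n : ℕ, Ω → Fin (n + 1)}

/-- The sources of randomness other than the points of the blocks: the sequence of blocks, and the
index of the block chosen at each step. -/
@[reducible]
def source (B : ℕ → Ω → Block u₀) (K : ∀ n : ℕ, Ω → Fin (n + 1)) : Option ℕ → MeasurableSpace Ω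
  | none => MeasurableSpace.comap (fun ω i => B i ω) inferInstance
  | some n => MeasurableSpace.comap (K n) inferInstance

/-- The σ-algebra generated by all the blocks and the indices chosen from time `m` on. -/
@[reducible]
def future (B : ℕ → Ω → Block u₀) (K : ∀ n : ℕ, Ω → Fin (n + 1)) (m : ℕ) : MeasurableSpace Ω :=
  ⨆ i ∈ {i : Option ℕ | ∀ n, i = some n → m ≤ n}, source B K i

theorem future_anti {m n : ℕ} (h : m ≤ n) : future B K n ≤ future B K m :=
  biSup_mono fun _ hi j hj => h.trans (hi j hj)

theorem measurable_block_future (m n : ℕ) : Measurable[future B K m] (B n) := by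
  have h1 : source B K none ≤ future B K m :=
    le_biSup (source B K) (i := none) fun n hn => by simp at hn
  have h2 : Measurable[source B K none] fun ω i => B i ω := comap_measurable _
  exact ((measurable_pi_apply n).comp h2).mono h1 le_rfl

theorem measurable_index_future (m : ℕ) : Measurable[future B K m] (K m) := by
  have h1 : source B K (some m) ≤ future B K m :=
    le_biSup (source B K) (i := some m) fun n hn => by simp at hn; omega
  have h2 : Measurable[source B K (some m)] (K m) := comap_measurable _
  exact h2.mono h1 le_rfl

/-- The indicator of the event that block `n + 1` is grafted on block `m`. -/
def graftInd (K : ∀ n : ℕ, Ω → Fin (n + 1)) (n m : ℕ) : Ω → ℝ≥0∞ :=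
  Set.indicator {ω | (K n ω : ℕ) = m} 1

theorem measurable_graftInd {n m : ℕ} {mΩ : MeasurableSpace Ω} (h : Measurable[mΩ] (K n)) :
    Measurable[mΩ] (graftInd K n m) :=
  measurable_one.indicator (h (MeasurableSet.of_discrete (s := {j : Fin (n + 1) | (j : ℕ) = m})))

variable [MeasurableSpace Ω] {P : Measure Ω} {w : ℕ → ℝ} {τ : Measure (Block u₀)} {Z : ℕ → Ω → U}

theorem graftLaw_prod_univ (b : ℕ → Block u₀) (n : ℕ) (c : Set (Fin (n + 1))) :
    graftLaw w b n (c ×ˢ Set.univ) = pickLaw w n c := by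
  simp [graftLaw, pickLaw, Measure.finsetSum_apply, Measure.smul_apply, Measure.prod_prod]

theorem IsRandomGluing.measure_box (hglue : IsRandomGluing P τ w B K Z) (n : ℕ)
    {A : Set (ℕ → Block u₀)} (hA : MeasurableSet A) (c : ∀ i : ℕ, Set (Fin (i + 1))) :
    P ({ω | (fun i => B i ω) ∈ A} ∩ {ω | ∀ i < n, K i ω ∈ c i}) =
      P {ω | (fun i => B i ω) ∈ A} * ∏ i ∈ Finset.range n, pickLaw w i (c i) := by
  have h := hglue.cond_graft n A (fun i => c i ×ˢ Set.univ) hA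
    fun i => MeasurableSet.of_discrete.prod MeasurableSet.univ
  simp only [graftLaw_prod_univ, lintegral_const, Set.mem_prod, Set.mem_univ, and_true] at h
  rw [h, Measure.restrict_apply MeasurableSet.univ, Set.univ_inter, mul_comm]

theorem IsRandomGluing.measure_index [IsProbabilityMeasure P]
    (hglue : IsRandomGluing P τ w B K Z) (hw : ∀ n, 0 ≤ w n) (hw₀ : 0 < w 0) (n : ℕ)
    (c : Set (Fin (n + 1))) : P {ω | K n ω ∈ c} = pickLaw w n c := by
  classical
  have h := hglue.measure_box (n + 1) MeasurableSet.univ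
    (fun i => if hi : i = n then hi ▸ c else Set.univ)
  have hset : {ω | ∀ i < n + 1, K i ω ∈ (if hi : i = n then hi ▸ c else Set.univ)} =
      {ω | K n ω ∈ c} := by
    ext ω
    constructor
    · intro hω
      have := hω n (Nat.lt_succ_self n)
      simpa using this
    · intro hω i _
      by_cases hi : i = n
      · subst hi
        simpa using hω
      · simp [hi]
  rw [hset] at h
  rw [Finset.prod_eq_single n] at h
  · simpa using h
  · intro i _ hi
    simp [hi, pickLaw_univ hw hw₀]
  · simp

theorem IsRandomGluing.source_le (hglue : IsRandomGluing P τ w B K Z) (i : Option ℕ) :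
    source B K i ≤ ‹MeasurableSpace Ω› := by
  cases i with
  | none => exact (measurable_pi_lambda _ hglue.measurable_block).comap_le
  | some n => exact (hglue.measurable_index n).comap_le

/-- The law of the indices given the blocks does not depend on the blocks, so the probability of a
box is a product; coordinates outside `s` are filled with the whole space. -/
theorem IsRandomGluing.iIndep_source [IsProbabilityMeasure P]
    (hglue : IsRandomGluing P τ w B K Z) (hw : ∀ n, 0 ≤ w n) (hw₀ : 0 < w 0) :
    iIndep (source B K) P := by
  classical
  rw [iIndep_iff]
  intro s f hf
  obtain ⟨A, hA, hA1, hA2⟩ : ∃ A : Set (ℕ → Block u₀), MeasurableSet A ∧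
      (none ∈ s → {ω | (fun i => B i ω) ∈ A} = f none) ∧ (none ∉ s → A = Set.univ) := by
    by_cases h : none ∈ s
    · obtain ⟨A, hA, hA'⟩ := hf none h
      exact ⟨A, hA, fun _ => hA', fun h' => absurd h h'⟩
    · exact ⟨Set.univ, MeasurableSet.univ, fun h' => absurd h' h, fun _ => rfl⟩
  have hc : ∀ n, ∃ c : Set (Fin (n + 1)),
      (some n ∈ s → {ω | K n ω ∈ c} = f (some n)) ∧ (some n ∉ s → c = Set.univ) := by
    intro n
    by_cases h : some n ∈ s
    · obtain ⟨c, -, hc⟩ := hf (some n) h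
      exact ⟨c, fun _ => hc, fun h' => absurd h h'⟩
    · exact ⟨Set.univ, fun h' => absurd h' h, fun _ => rfl⟩
  choose c hc1 hc2 using hc
  obtain ⟨N, hN⟩ : ∃ N, ∀ n, some n ∈ s → n < N :=
    ⟨s.eraseNone.sup id + 1, fun n hn => Nat.lt_succ_of_le
      (Finset.le_sup (f := id) (Finset.mem_eraseNone.2 hn))⟩
  let g : Option ℕ → ℝ≥0∞ := fun i => i.elim (P {ω | (fun i => B i ω) ∈ A})
    fun n => pickLaw w n (c n)
  have hg : ∀ i ∈ s, P (f i) = g i := by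
    rintro (_ | n) hi
    · rw [← hA1 hi]; rfl
    · rw [← hc1 n hi, hglue.measure_index hw hw₀]; rfl
  have hg1 : ∀ i ∉ s, g i = 1 := by
    rintro (_ | n) hi
    · simp [g, hA2 hi]
    · simp [g, hc2 n hi, pickLaw_univ hw hw₀]
  have hset : ⋂ i ∈ s, f i =
      {ω | (fun i => B i ω) ∈ A} ∩ {ω | ∀ i < N, K i ω ∈ c i} := by
    ext ω
    simp only [Set.mem_iInter, Set.mem_inter_iff]
    constructor
    · refine fun h => ⟨?_, fun n _ => ?_⟩
      · by_cases hs : none ∈ s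
        · exact (hA1 hs).symm ▸ h none hs
        · simp [hA2 hs]
      · by_cases hs : some n ∈ s
        · have := h (some n) hs
          rwa [← hc1 n hs] at this
        · simp [hc2 n hs]
    · rintro ⟨h1, h2⟩ (_ | n) hi
      · rwa [← hA1 hi]
      · rw [← hc1 n hi]
        exact h2 n (hN n hi)
  rw [hset, hglue.measure_box N hA, Finset.prod_congr rfl hg,
    Finset.prod_subset (s₂ := (Finset.range N).insertNone)]
  · rw [Finset.prod_insertNone]; rfl
  · rintro (_ | n) hi
    · simp
    · simpa using hN n hi
  · exact fun i _ hi => hg1 i hi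

theorem IsRandomGluing.future_le (hglue : IsRandomGluing P τ w B K Z) (m : ℕ) :
    future B K m ≤ ‹MeasurableSpace Ω› :=
  iSup₂_le fun i _ => hglue.source_le i

/-- `K n` is independent of all blocks and of the choices made after time `n`. This drives every
expectation over the genealogy. -/
theorem IsRandomGluing.lintegral_graftInd_mul_le [IsProbabilityMeasure P]
    (hglue : IsRandomGluing P τ w B K Z)
    (hw : ∀ n, 0 ≤ w n) (hw₀ : 0 < w 0) (n m : ℕ) {F : Ω → ℝ≥0∞}
    (hF : Measurable[future B K (n + 1)] F) :
    ∫⁻ ω, graftInd K n m ω * F ω ∂P ≤ ENNReal.ofReal (w m / w 0) * ∫⁻ ω, F ω ∂P := by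
  have hind : Indep (source B K (some n)) (future B K (n + 1)) P := by
    have h := indep_iSup_of_disjoint hglue.source_le (hglue.iIndep_source hw hw₀)
      (S := {some n}) (T := {i : Option ℕ | ∀ j, i = some j → n + 1 ≤ j}) (by
        rw [Set.disjoint_singleton_left]
        intro h
        have := h n rfl
        omega)
    rw [future]
    simpa only [Set.mem_singleton_iff, iSup_iSup_eq_left] using h
  rw [lintegral_mul_eq_lintegral_mul_lintegral_of_independent_measurableSpace
    (hglue.source_le (some n)) (hglue.future_le (n + 1)) hind
    (measurable_graftInd (comap_measurable _)) hF]
  refine mul_le_mul_left ?_ _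
  have hm : MeasurableSet {ω | (K n ω : ℕ) = m} :=
    hglue.measurable_index n (MeasurableSet.of_discrete (s := {j : Fin (n + 1) | (j : ℕ) = m}))
  rw [graftInd, lintegral_indicator_one hm]
  exact (hglue.measure_index hw hw₀ n {j | (j : ℕ) = m}).trans_le (pickLaw_le hw hw₀ n m)

/-- If `Z n` missed its compact block, some basic open set would contain it and avoid the block.
There are countably many such sets, and for each the event is null since the mass of the block lives
on its carrier. -/
theorem IsRandomGluing.ae_graft_mem [SecondCountableTopology U] [BorelSpace U]
    (hglue : IsRandomGluing P τ w B K Z) :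
    ∀ᵐ ω ∂P, ∀ n, Z n ω ∈ ((B (K n ω) ω).carrier : Set U) := by
  have key : ∀ n : ℕ, ∀ j : Fin (n + 1), ∀ O ∈ countableBasis U,
      P {ω | ¬ (((B j ω).carrier : Set U) ∩ O).Nonempty ∧ K n ω = j ∧ Z n ω ∈ O} = 0 := by
    intro n j O hO
    have hOo := isOpen_of_mem_countableBasis hO
    classical
    have hAm : MeasurableSet {b : ℕ → Block u₀ | ¬ (((b j).carrier : Set U) ∩ O).Nonempty} :=
      (measurable_pi_apply (X := fun _ : ℕ => Block u₀) (j : ℕ))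
        (measurableSet_disjoint_carrier hOo)
    have h := hglue.cond_graft (n + 1) _
      (fun i => if hi : i = n then {p | (p.1 : ℕ) = j ∧ p.2 ∈ O} else Set.univ) hAm (by
        intro i
        obtain rfl | hi := eq_or_ne i n
        · simp only [dite_true]
          exact (measurable_fst
            (MeasurableSet.of_discrete (s := {q : Fin (i + 1) | (q : ℕ) = j}))).inter
            (measurable_snd hOo.measurableSet)
        · simp [hi])
    refine measure_mono_null ?_ (h.trans ?_)
    · rintro ω ⟨h1, h2, h3⟩
      refine ⟨h1, fun i _ => ?_⟩
      by_cases hi : i = n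
      · subst hi
        simp [h2, h3]
      · simp [hi]
    · rw [setLIntegral_congr_fun (g := fun _ => 0)]
      · simp
      · exact measurable_pi_lambda _ hglue.measurable_block hAm
      · intro ω hω
        refine Finset.prod_eq_zero (Finset.mem_range.2 (Nat.lt_succ_self n)) ?_
        simp only [dite_true, graftLaw, Measure.finsetSum_apply, Measure.smul_apply, smul_eq_mul]
        refine Finset.sum_eq_zero fun q _ => ?_
        have hprod : {p : Fin (n + 1) × U | (p.1 : ℕ) = j ∧ p.2 ∈ O} =
          {q : Fin (n + 1) | (q : ℕ) = j} ×ˢ O := rfl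
        rw [hprod, Measure.prod_prod]
        by_cases hq : q = j
        · subst hq
          have h0 : ((B q ω).mass : Measure U) O = 0 := by
            have h1 := (prob_compl_eq_zero_iff₀
              (B q ω).carrier.isCompact.measurableSet.nullMeasurableSet).2 (B q ω).mass_carrier
            exact measure_mono_null (fun x hx => fun hx' => hω ⟨x, hx', hx⟩) h1
          simp [h0]
        · rw [Measure.dirac_apply' _ (MeasurableSet.of_discrete)]
          have : (q : ℕ) ≠ j := fun h => hq (Fin.ext h)
          simp [this]
  have key2 : ∀ᵐ ω ∂P, ∀ n : ℕ, ∀ j : Fin (n + 1), ∀ O ∈ countableBasis U,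
      ¬ (¬ (((B j ω).carrier : Set U) ∩ O).Nonempty ∧ K n ω = j ∧ Z n ω ∈ O) := by
    rw [ae_all_iff]; intro n
    rw [ae_all_iff]; intro j
    rw [ae_ball_iff (countable_countableBasis U)]
    intro O hO
    rw [ae_iff]
    simpa only [not_not] using key n j O hO
  filter_upwards [key2] with ω hω n
  by_contra hcon
  obtain ⟨O, hO, hZ, hsub⟩ := (isBasis_countableBasis U).exists_subset_of_mem_open hcon
    (B (K n ω) ω).carrier.isCompact.isClosed.isOpen_compl
  refine hω n (K n ω) O hO ⟨?_, rfl, hZ⟩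
  rintro ⟨x, hx, hxO⟩
  exact hsub hxO hx

/-- The first-moment form of the Borel–Cantelli lemma. -/
theorem ae_tsum_ne_top {f : ℕ → Ω → ℝ≥0∞} (hf : ∀ n, Measurable (f n))
    (h : ∑' n, ∫⁻ ω, f n ω ∂P ≠ ∞) : ∀ᵐ ω ∂P, ∑' n, f n ω ≠ ∞ := by
  rw [← lintegral_tsum fun n => (hf n).aemeasurable] at h
  filter_upwards [ae_lt_top (Measurable.tsum hf) h] with ω hω using hω.ne

end Independence

/-! ### Sums of powers and first-moment estimates. -/

/-- The right-hand side is the integral of `x ^ (-a)` over `[n, n + 1]`; Bernoulli's inequality for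
an exponent in `(0, 1]` replaces the integral. -/
theorem rpow_neg_succ_le {a : ℝ} (ha0 : 0 ≤ a) (ha1 : a < 1) (n : ℕ) :
    ((n : ℝ) + 1) ^ (-a) ≤ (((n : ℝ) + 1) ^ (1 - a) - (n : ℝ) ^ (1 - a)) / (1 - a) := by
  have hn : (0 : ℝ) < (n : ℝ) + 1 := by positivity
  rw [le_div_iff₀ (by linarith)]
  have h1 := rpow_one_add_le_one_add_mul_self (s := -1 / ((n : ℝ) + 1))
    (by rw [le_div_iff₀ hn]; linarith [Nat.cast_nonneg (α := ℝ) n]) (p := 1 - a) (by linarith)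
    (by linarith)
  have h2 : 1 + -1 / ((n : ℝ) + 1) = n / (n + 1) := by field_simp; ring
  rw [h2, Real.div_rpow (by positivity) hn.le, div_le_iff₀ (by positivity)] at h1
  have h3 : ((n : ℝ) + 1) ^ (1 - a) = (n + 1) * ((n : ℝ) + 1) ^ (-a) := by
    rw [sub_eq_add_neg, Real.rpow_add hn, Real.rpow_one]
  have h4 : (1 + (1 - a) * (-1 / ((n : ℝ) + 1))) * ((n : ℝ) + 1) ^ (1 - a) =
      ((n : ℝ) + 1) ^ (1 - a) - (1 - a) * ((n : ℝ) + 1) ^ (-a) := by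
    rw [h3]; field_simp; ring
  rw [h4] at h1
  linarith

theorem sum_rpow_neg_succ_le {a : ℝ} (ha0 : 0 ≤ a) (ha1 : a < 1) (m Y : ℕ) :
    ∑ n ∈ Finset.Ico m Y, ((n + 1 : ℕ) : ℝ) ^ (-a) ≤ (Y : ℝ) ^ (1 - a) / (1 - a) := by
  have h1 : ∑ n ∈ Finset.range Y, ((n + 1 : ℕ) : ℝ) ^ (-a) ≤ (Y : ℝ) ^ (1 - a) / (1 - a) := by
    induction Y with
    | zero => simp [Real.zero_rpow (by linarith : 1 - a ≠ 0)]
    | succ Y ih =>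
      rw [Finset.sum_range_succ]
      have := rpow_neg_succ_le ha0 ha1 Y
      rw [sub_div] at this
      push_cast at *
      linarith
  refine (Finset.sum_le_sum_of_subset_of_nonneg (fun n hn => ?_) fun _ _ _ => ?_).trans h1
  · simp at hn ⊢; omega
  · positivity

section Tail

variable {Ω : Type*} [MeasurableSpace Ω] {P : Measure Ω}

theorem ae_tsum_tail_ne_top {f : ℕ → Ω → ℝ≥0∞} (hf : ∀ n, Measurable (f n)) {C a : ℝ} {N : ℕ}
    (ha : 1 < a) (h : ∀ n, N ≤ n → ∫⁻ ω, f n ω ∂P ≤ ENNReal.ofReal (C * (n : ℝ) ^ (-a))) :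
    ∀ᵐ ω ∂P, ∑' n, f (n + N) ω ≠ ∞ := by
  refine ae_tsum_ne_top (fun n => hf (n + N)) ?_
  have hs : Summable fun n : ℕ => C * ((n + N : ℕ) : ℝ) ^ (-a) :=
    ((summable_nat_add_iff N).2 (Real.summable_nat_rpow.2 (by linarith))).mul_left C
  refine ne_top_of_le_ne_top hs.tsum_ofReal_ne_top ?_
  exact ENNReal.tsum_le_tsum fun n => h (n + N) (by omega)

theorem ae_tendsto_zero {f : ℕ → Ω → ℝ≥0∞} (hf : ∀ n, Measurable (f n)) {C a : ℝ} {N : ℕ}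
    (ha : 1 < a) (h : ∀ n, N ≤ n → ∫⁻ ω, f n ω ∂P ≤ ENNReal.ofReal (C * (n : ℝ) ^ (-a))) :
    ∀ᵐ ω ∂P, Tendsto (fun n => f n ω) atTop (𝓝 0) := by
  filter_upwards [ae_tsum_tail_ne_top hf ha h] with ω hω
  exact (tendsto_add_atTop_iff_nat N).1 (ENNReal.tendsto_atTop_zero_of_tsum_ne_top hω)

end Tail

/-! ### Diameters of blocks and growth of indices along lines of descent. -/

section Chains

variable {Ω : Type*} {U : Type*} [MetricSpace U] [MeasurableSpace U] {u₀ : U}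
  {B : ℕ → Ω → Block u₀} {K : ∀ n : ℕ, Ω → Fin (n + 1)}

/-- The number of descendants of block `m` of index less than `M`, `j` generations below it. -/
def chainCount (K : ∀ n : ℕ, Ω → Fin (n + 1)) (M : ℕ) : ℕ → ℕ → Ω → ℝ≥0∞
  | 0, m => fun _ => if m < M then 1 else 0
  | j + 1, m => fun ω => ∑ n ∈ Finset.Ico m M, graftInd K n m ω * chainCount K M j (n + 1) ω

theorem measurable_sum_graftInd {V : ℕ → Ω → ℝ≥0∞} (hV : ∀ m, Measurable[future B K m] (V m))
    (m M : ℕ) : Measurable[future B K m]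
      fun ω => ∑ n ∈ Finset.Ico m M, graftInd K n m ω * V (n + 1) ω := by
  refine Finset.measurable_fun_sum _ fun n hn => ?_
  have hmn := (Finset.mem_Ico.1 hn).1
  exact ((measurable_graftInd (measurable_index_future n)).mono (future_anti hmn) le_rfl).mul
    ((hV (n + 1)).mono (future_anti (by omega)) le_rfl)

theorem measurable_chainCount (M j m : ℕ) : Measurable[future B K m] (chainCount K M j m) := by
  induction j generalizing m with
  | zero => exact measurable_const
  | succ j ih => exact measurable_sum_graftInd ih m M

theorem one_le_chainCount {M j m i : ℕ} {ω : Ω} (h : IsDesc (fun n => K n ω) j m i) (hi : i < M) :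
    1 ≤ chainCount K M j m ω := by
  induction j generalizing m with
  | zero =>
    cases (show m = i from h)
    simp [chainCount, hi]
  | succ j ih =>
    obtain ⟨n, hn, h⟩ := h
    have h1 := ih h
    have h2 := h.le
    have h3 := (K n ω).isLt
    have h4 : n ∈ Finset.Ico m M := by simp; omega
    refine le_trans ?_ (Finset.single_le_sum
      (f := fun n => graftInd K n m ω * chainCount K M j (n + 1) ω) (fun _ _ => zero_le) h4)
    have h5 : graftInd K n m ω = 1 := Set.indicator_of_mem (s := {ω | (K n ω : ℕ) = m}) hn 1
    simpa [h5] using h1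

variable [MeasurableSpace Ω] {P : Measure Ω} {w : ℕ → ℝ} {τ : Measure (Block u₀)} {Z : ℕ → Ω → U}

theorem IsRandomGluing.lintegral_block (hglue : IsRandomGluing P τ w B K Z)
    {f : Block u₀ → ℝ≥0∞} (hf : Measurable f) (n : ℕ) :
    ∫⁻ ω, f (B n ω) ∂P = ∫⁻ b, f b ∂τ := by
  rw [← hglue.law_block n, lintegral_map hf (hglue.measurable_block n)]

/-- A moment of order `k ≥ 2 / ε` makes the diameter of block `n` almost surely at most `n ^ ε`
eventually, by Borel–Cantelli with the summable weights `n ^ (-2)`. -/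
theorem IsRandomGluing.ae_diam_le (hglue : IsRandomGluing P τ w B K Z) {lam : ℕ → ℝ}
    (hlam : ∀ n, 0 < lam n) {α ε : ℝ} (hε : 0 < ε)
    (hlamα : ∀ᶠ n : ℕ in atTop, lam n ≤ (n : ℝ) ^ (-α - ε))
    (hdiam : ∀ k : ℕ, ∫⁻ b, ENNReal.ofReal (Metric.diam (b.carrier : Set U) ^ k) ∂τ < ∞) :
    ∀ᵐ ω ∂P, ∀ᶠ n : ℕ in atTop,
      lam n * Metric.diam ((B n ω).carrier : Set U) ≤ (n : ℝ) ^ (-α) := by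
  obtain ⟨k, hk⟩ := exists_nat_ge (2 / ε)
  have hk2 : 2 ≤ ε * k := by rwa [div_le_iff₀' hε] at hk
  have hk0 : k ≠ 0 := by
    rintro rfl
    norm_num at hk2
  set f : ℕ → Block u₀ → ℝ≥0∞ := fun n b =>
    ENNReal.ofReal (Metric.diam (b.carrier : Set U) ^ k) * ENNReal.ofReal ((n : ℝ) ^ (-2 : ℝ))
  have hfm : ∀ n, Measurable (f n) := fun n =>
    ((measurable_diam.pow_const k).ennreal_ofReal).mul_const _
  have hb : ∀ n, 0 ≤ n → ∫⁻ ω, f n (B n ω) ∂P ≤ ENNReal.ofReal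
      ((∫⁻ b, ENNReal.ofReal (Metric.diam (b.carrier : Set U) ^ k) ∂τ).toReal *
        (n : ℝ) ^ (-2 : ℝ)) := by
    intro n _
    rw [hglue.lintegral_block (hfm n), lintegral_mul_const _
      (measurable_diam.pow_const k).ennreal_ofReal, ENNReal.ofReal_mul ENNReal.toReal_nonneg,
      ENNReal.ofReal_toReal (hdiam k).ne]
  filter_upwards [ae_tendsto_zero (fun n => (hfm n).comp (hglue.measurable_block n))
    (by norm_num) hb] with ω hω
  filter_upwards [hω.eventually (gt_mem_nhds zero_lt_one), hlamα, eventually_ge_atTop 1]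
    with n h1 h2 hn
  have hn0 : (1 : ℝ) ≤ n := by exact_mod_cast hn
  have hn1 : (0 : ℝ) < n := by linarith
  set D := Metric.diam ((B n ω).carrier : Set U) with hD
  have hD0 : 0 ≤ D := Metric.diam_nonneg
  have h3 : D ^ k * (n : ℝ) ^ (-2 : ℝ) < 1 := by
    have h1' : ENNReal.ofReal (D ^ k) * ENNReal.ofReal ((n : ℝ) ^ (-2 : ℝ)) < 1 := h1
    rwa [← ENNReal.ofReal_mul (by positivity), ENNReal.ofReal_lt_one] at h1'
  have h4 : D ^ k ≤ ((n : ℝ) ^ ε) ^ k := by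
    rw [Real.rpow_neg hn1.le, mul_inv_lt_iff₀ (by positivity), one_mul] at h3
    rw [← Real.rpow_mul_natCast hn1.le]
    exact h3.le.trans (Real.rpow_le_rpow_of_exponent_le hn0 hk2)
  have h5 : D ≤ (n : ℝ) ^ ε := (pow_le_pow_iff_left₀ hD0 (by positivity) hk0).1 h4
  calc lam n * D ≤ (n : ℝ) ^ (-α - ε) * (n : ℝ) ^ ε := by
        have := (hlam n).le
        gcongr
    _ = (n : ℝ) ^ (-α) := by rw [← Real.rpow_add hn1]; ring_nf

variable [IsProbabilityMeasure P]

theorem IsRandomGluing.lintegral_sum_graftInd_le (hglue : IsRandomGluing P τ w B K Z)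
    (hw : ∀ n, 0 ≤ w n) (hw₀ : 0 < w 0) {V : ℕ → Ω → ℝ≥0∞}
    (hV : ∀ m, Measurable[future B K m] (V m)) (m M : ℕ) :
    ∫⁻ ω, ∑ n ∈ Finset.Ico m M, graftInd K n m ω * V (n + 1) ω ∂P ≤
      ENNReal.ofReal (w m / w 0) * ∑ n ∈ Finset.Ico m M, ∫⁻ ω, V (n + 1) ω ∂P := by
  rw [lintegral_finsetSum, Finset.mul_sum]
  · exact Finset.sum_le_sum fun n _ => hglue.lintegral_graftInd_mul_le hw hw₀ n m (hV (n + 1))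
  · exact fun n _ => (measurable_graftInd (hglue.measurable_index n)).mul
      ((hV (n + 1)).mono (hglue.future_le _) le_rfl)

/-- Each generation offers at most `M` grafting times, each used with probability at most `q`. -/
theorem IsRandomGluing.lintegral_chainCount_le (hglue : IsRandomGluing P τ w B K Z)
    (hw : ∀ n, 0 ≤ w n) (hw₀ : 0 < w 0) {N M : ℕ} {q : ℝ} (hq : ∀ i, N ≤ i → w i / w 0 ≤ q)
    (j m : ℕ) (hm : N ≤ m) :
    ∫⁻ ω, chainCount K M j m ω ∂P ≤ (ENNReal.ofReal q * M) ^ j := by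
  induction j generalizing m with
  | zero =>
    by_cases h : m < M <;> simp [chainCount, h]
  | succ j ih =>
    refine (hglue.lintegral_sum_graftInd_le hw hw₀ (measurable_chainCount M j) m M).trans ?_
    calc ENNReal.ofReal (w m / w 0) *
          ∑ n ∈ Finset.Ico m M, ∫⁻ ω, chainCount K M j (n + 1) ω ∂P
        ≤ ENNReal.ofReal q * ∑ n ∈ Finset.Ico m M, (ENNReal.ofReal q * M) ^ j := by
          gcongr with n hn
          · exact hq m hm
          · exact ih (n + 1) (by have := (Finset.mem_Ico.1 hn).1; omega)
      _ ≤ ENNReal.ofReal q * (M * (ENNReal.ofReal q * M) ^ j) := by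
          rw [Finset.sum_const, Nat.card_Ico, nsmul_eq_mul]
          gcongr
          omega
      _ = (ENNReal.ofReal q * M) ^ (j + 1) := by ring

/-- The expected number of descendants of `n` of index below `2 * n`, `l` generations down, is at
most `(n ^ (-β) * 2 * n) ^ l`, which is summable by the choice of `l`. -/
theorem IsRandomGluing.ae_doubling (hglue : IsRandomGluing P τ w B K Z)
    (hw : ∀ n, 0 ≤ w n) (hw₀ : 0 < w 0) {β : ℝ} (hβ : 1 < β)
    (hwβ : ∀ᶠ n : ℕ in atTop, w n / w 0 ≤ (n : ℝ) ^ (-β)) {l : ℕ} (hl : 1 < (β - 1) * l) :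
    ∀ᵐ ω ∂P, ∀ᶠ n : ℕ in atTop, ∀ i, IsDesc (fun n => K n ω) l n i → 2 * n ≤ i := by
  obtain ⟨N, hN⟩ := eventually_atTop.1 (hwβ.and (eventually_ge_atTop 1))
  have hbound : ∀ n, N ≤ n → ∫⁻ ω, chainCount K (2 * n) l n ω ∂P ≤
      ENNReal.ofReal (2 ^ l * (n : ℝ) ^ (-((β - 1) * l))) := by
    intro n hn
    have hn1 : (0 : ℝ) < n := by exact_mod_cast (hN n hn).2
    refine (hglue.lintegral_chainCount_le hw hw₀ (N := n) (q := (n : ℝ) ^ (-β)) ?_ l n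
      le_rfl).trans (le_of_eq ?_)
    · intro i hi
      exact (hN i (hn.trans hi)).1.trans (Real.rpow_le_rpow_of_nonpos hn1 (by exact_mod_cast hi)
        (by linarith))
    · have h1 : (n : ℝ) ^ (-β) * ((2 * n : ℕ) : ℝ) = 2 * (n : ℝ) ^ (-(β - 1)) := by
        have : (n : ℝ) ^ (-(β - 1)) = (n : ℝ) ^ (-β) * n := by
          rw [show -(β - 1) = -β + 1 by ring, Real.rpow_add hn1, Real.rpow_one]
        rw [this]; push_cast; ring
      rw [← ENNReal.ofReal_natCast, ← ENNReal.ofReal_mul (by positivity), h1,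
        ← ENNReal.ofReal_pow (by positivity), mul_pow, ← Real.rpow_mul_natCast hn1.le, neg_mul]
  have hmeas : ∀ n, Measurable (chainCount K (2 * n) l n) := fun n =>
    (measurable_chainCount (B := B) _ _ _).mono (hglue.future_le n) le_rfl
  filter_upwards [ae_tendsto_zero hmeas hl hbound] with ω hω
  filter_upwards [hω.eventually (gt_mem_nhds zero_lt_one)] with n hn i hi
  by_contra hcon
  exact absurd (one_le_chainCount hi (not_le.1 hcon)) hn.not_ge

end Chains

/-! ### Expected covering cost and its iterative improvement. -/

section Cost

variable {Ω : Type*} [MeasurableSpace Ω] {U : Type*} [MetricSpace U] [MeasurableSpace U] {u₀ : U}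
  {lam : ℕ → ℝ} {hlam : ∀ n, 0 < lam n} {B : ℕ → Ω → Block u₀}
  {K : ∀ n : ℕ, Ω → Fin (n + 1)} {Z : ℕ → Ω → U} {P : Measure Ω}

variable (P lam hlam B K Z) in
/-- The subtree of block `m` can be covered with an expected `s`-dimensional cost of order
`m ^ (-a)`. The cost is bounded by a random variable which only depends on the blocks and on the
indices chosen from time `m` on. -/
def CostBound (α A s a : ℝ) : Prop :=
  ∃ (V : ℕ → Ω → ℝ≥0∞) (C : ℝ) (N : ℕ), 0 ≤ C ∧ 1 ≤ N ∧
    (∀ m, Measurable[future B K m] (V m)) ∧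
    (∀ m, N ≤ m → ∫⁻ ω, V m ω ∂P ≤ ENNReal.ofReal (C * (m : ℝ) ^ (-a))) ∧
    ∀ ω n₀, Controlled lam hlam (fun n => B n ω) (fun n => K n ω) (fun n => Z n ω) α A n₀ →
      ∀ m, n₀ ≤ m → N ≤ m → ∀ δ : ℝ≥0∞, ENNReal.ofReal (2 * ((1 + A) * (m : ℝ) ^ (-α))) ≤ δ →
        hausdorffPre s δ (closure (subtree lam hlam (fun n => B n ω) (fun n => K n ω)
          (fun n => Z n ω) m)) ≤ V m ω

theorem CostBound.mono {α A s a a' : ℝ} (h : CostBound lam hlam B K Z P α A s a) (ha : a' ≤ a) :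
    CostBound lam hlam B K Z P α A s a' := by
  obtain ⟨V, C, N, hC, hN, h1, h2, h3⟩ := h
  refine ⟨V, C, N, hC, hN, h1, fun m hm => (h2 m hm).trans (ENNReal.ofReal_le_ofReal ?_), h3⟩
  have hm1 : (1 : ℝ) ≤ m := by exact_mod_cast hN.trans hm
  exact mul_le_mul_of_nonneg_left (Real.rpow_le_rpow_of_exponent_le hm1 (by linarith)) hC

theorem ofReal_radius_rpow {A α s x : ℝ} (hA : 0 ≤ A) (hs : 0 ≤ s) (hx : 0 < x) :
    ENNReal.ofReal (2 * ((1 + A) * x ^ (-α))) ^ s =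
      ENNReal.ofReal ((2 * (1 + A)) ^ s * x ^ (-(α * s))) := by
  rw [ENNReal.ofReal_rpow_of_nonneg (by positivity) hs, ← mul_assoc,
    Real.mul_rpow (by positivity) (by positivity), ← Real.rpow_mul hx.le, neg_mul]

theorem CostBound.of_ball [IsProbabilityMeasure P] {α A s : ℝ} (hA : 0 ≤ A) (hs : 0 ≤ s) :
    CostBound lam hlam B K Z P α A s (α * s) := by
  refine ⟨fun m _ => ENNReal.ofReal (2 * ((1 + A) * (m : ℝ) ^ (-α))) ^ s, (2 * (1 + A)) ^ s, 1,
    by positivity, le_rfl, fun m => measurable_const, fun m hm => ?_, ?_⟩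
  · have hm1 : (0 : ℝ) < m := by exact_mod_cast hm
    rw [lintegral_const, measure_univ, mul_one, ofReal_radius_rpow hA hs hm1]
  · intro ω n₀ h m hm _ δ hδ
    refine (measure_mono ?_).trans (hausdorffPre_closedBall_le hs (blockPoint u₀ lam hlam
      (fun n => K n ω) (fun n => Z n ω) m u₀) hδ)
    refine closure_minimal ((h.subtree_subset m hm).trans (Metric.closedBall_subset_closedBall ?_))
      Metric.isClosed_closedBall
    have : 0 ≤ (m : ℝ) ^ (-α) := by positivity
    linarith

/-- Cut at time `m ^ γ`. Hypothesis `hγa` equates the cost of the block with its late subtrees and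
the cost of the early subtrees. -/
theorem CostBound.improve [IsProbabilityMeasure P] {w : ℕ → ℝ} {τ : Measure (Block u₀)}
    (hglue : IsRandomGluing P τ w B K Z) (hw : ∀ n, 0 ≤ w n) (hw₀ : 0 < w 0)
    {α β d A s a γ : ℝ} (hα : 0 < α) (hA : 0 ≤ A) (hs : 0 ≤ s)
    (hlamα : ∀ᶠ n : ℕ in atTop, lam n ≤ (n : ℝ) ^ (-α))
    (hwβ : ∀ᶠ n : ℕ in atTop, w n / w 0 ≤ (n : ℝ) ^ (-β))
    (hball : ∀ᶠ r : ℝ in 𝓝[>] 0,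
      ∫⁻ b, ((ballNumber r (b.carrier : Set U) : ℕ∞) : ℝ≥0∞) ∂τ ≤ ENNReal.ofReal (r ^ (-d)))
    (ha0 : 0 ≤ a) (ha1 : a < 1) (hγ : 1 < γ) (hγa : γ * (α * (s - d) + 1 - a) = β - α * d)
    (h : CostBound lam hlam B K Z P α A s a) :
    CostBound lam hlam B K Z P α A s (α * d + γ * (α * (s - d))) := by
  obtain ⟨V, C, N, hC, hN, hVm, hVE, hV⟩ := h
  have hrad : Tendsto (fun m : ℕ => (m : ℝ) ^ (-((γ - 1) * α))) atTop (𝓝[>] 0) := by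
    refine tendsto_nhdsWithin_iff.2 ⟨?_, ?_⟩
    · exact (tendsto_rpow_neg_atTop (mul_pos (sub_pos.2 hγ) hα)).comp tendsto_natCast_atTop_atTop
    · filter_upwards [eventually_ge_atTop 1] with m hm
      have hm1 : (0 : ℝ) < m := by exact_mod_cast hm
      exact Real.rpow_pos_of_pos hm1 _
  obtain ⟨N', hN'⟩ := eventually_atTop.1 (hlamα.and (hwβ.and (hrad.eventually hball)))
  set Y : ℕ → ℕ := fun m => ⌊(m : ℝ) ^ γ⌋₊ with hY
  -- Radius before dilation: multiplied by `lam m ≤ m ^ (-α)`, it becomes at most `m ^ (-(γ * α))`.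
  set r : ℕ → ℝ := fun m => (m : ℝ) ^ (-((γ - 1) * α)) with hr
  set R : ℕ → ℝ≥0∞ := fun m => ENNReal.ofReal (2 * ((1 + A) * ((m : ℝ) ^ γ) ^ (-α))) ^ s with hR
  have hbm : ∀ m, 1 ≤ m → Measurable fun b : Block u₀ =>
      ((ballNumber (r m) (b.carrier : Set U) : ℕ∞) : ℝ≥0∞) := fun m hm =>
    measurable_ballNumber (Real.rpow_pos_of_pos (by exact_mod_cast hm) _)
  classical
  -- The case distinction excludes `m = 0`, where `r 0 = 0` and measurability of the covering number
  -- is not available.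
  refine ⟨fun m ω => (if 1 ≤ m then
        ((ballNumber (r m) ((B m ω).carrier : Set U) : ℕ∞) : ℝ≥0∞) * R m else 0) +
      ∑ n ∈ Finset.Ico m (Y m), graftInd K n m ω * V (n + 1) ω,
    (2 * (1 + A)) ^ s + C / (1 - a), max N N', ?_, hN.trans (le_max_left _ _), ?_, ?_, ?_⟩
  · have : 0 < 1 - a := by linarith
    positivity
  · intro m
    refine Measurable.add ?_ (measurable_sum_graftInd hVm m (Y m))
    by_cases hm : 1 ≤ m
    · simp only [hm, if_true]
      exact ((hbm m hm).comp (measurable_block_future m m)).mul_const _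
    · simp only [hm, if_false]
      exact measurable_const
  · intro m hm
    have hmN : N ≤ m := (le_max_left _ _).trans hm
    have hm1 : 1 ≤ m := hN.trans hmN
    have hm0 : (0 : ℝ) < m := by exact_mod_cast hm1
    obtain ⟨-, hw1, hb1⟩ := hN' m ((le_max_right _ _).trans hm)
    have hbB : Measurable fun ω => ((ballNumber (r m) ((B m ω).carrier : Set U) : ℕ∞) : ℝ≥0∞) :=
      (hbm m hm1).comp (hglue.measurable_block m)
    simp only [hm1, if_true]
    rw [lintegral_add_left (hbB.mul_const _),
      add_mul, ENNReal.ofReal_add (by positivity)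
        (mul_nonneg (div_nonneg hC (by linarith)) (by positivity))]
    refine add_le_add ?_ ?_
    · rw [lintegral_mul_const _ hbB]
      refine (mul_le_mul_left ((hglue.lintegral_block (hbm m hm1) m).trans_le hb1) _).trans
        (le_of_eq ?_)
      rw [hR]
      dsimp only
      rw [ofReal_radius_rpow hA hs (by positivity), ← ENNReal.ofReal_mul (by positivity),
        ← Real.rpow_mul hm0.le, ← Real.rpow_mul hm0.le, mul_left_comm, ← Real.rpow_add hm0]
      ring_nf
    · refine (hglue.lintegral_sum_graftInd_le hw hw₀ hVm m (Y m)).trans ?_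
      calc ENNReal.ofReal (w m / w 0) * ∑ n ∈ Finset.Ico m (Y m), ∫⁻ ω, V (n + 1) ω ∂P
          ≤ ENNReal.ofReal ((m : ℝ) ^ (-β)) * ∑ n ∈ Finset.Ico m (Y m),
              ENNReal.ofReal (C * ((n + 1 : ℕ) : ℝ) ^ (-a)) := by
            gcongr with n hn
            exact hVE (n + 1) (by have := (Finset.mem_Ico.1 hn).1; omega)
        _ = ENNReal.ofReal ((m : ℝ) ^ (-β) * (C *
              ∑ n ∈ Finset.Ico m (Y m), ((n + 1 : ℕ) : ℝ) ^ (-a))) := by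
            rw [← ENNReal.ofReal_sum_of_nonneg (fun n _ => by positivity),
              ← ENNReal.ofReal_mul (by positivity), ← Finset.mul_sum]
        _ ≤ ENNReal.ofReal ((m : ℝ) ^ (-β) * (C * (((m : ℝ) ^ γ) ^ (1 - a) / (1 - a)))) := by
            refine ENNReal.ofReal_le_ofReal ?_
            gcongr
            refine (sum_rpow_neg_succ_le ha0 ha1 m (Y m)).trans ?_
            have h1a : 0 < 1 - a := by linarith
            gcongr
            exact Nat.floor_le (by positivity)
        _ = ENNReal.ofReal (C / (1 - a) * (m : ℝ) ^ (-(α * d + γ * (α * (s - d))))) := by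
            congr 1
            rw [← Real.rpow_mul hm0.le,
              show -(α * d + γ * (α * (s - d))) = -β + γ * (1 - a) by linarith,
              Real.rpow_add hm0]
            ring
  · intro ω n₀ hcon m hmn hm δ hδ
    have hmN : N ≤ m := (le_max_left _ _).trans hm
    have hm1 : 1 ≤ m := hN.trans hmN
    have hm1' : (1 : ℝ) ≤ m := by exact_mod_cast hm1
    have hm0 : (0 : ℝ) < m := by linarith
    obtain ⟨hl1, -, -⟩ := hN' m ((le_max_right _ _).trans hm)
    have hmγ : (m : ℝ) ≤ (m : ℝ) ^ γ := Real.self_le_rpow_of_one_le hm1' hγ.le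
    have hmono : ∀ x : ℝ, (m : ℝ) ≤ x →
        ENNReal.ofReal (2 * ((1 + A) * x ^ (-α))) ≤ δ := by
      intro x hx
      refine le_trans (ENNReal.ofReal_le_ofReal ?_) hδ
      have := Real.rpow_le_rpow_of_nonpos hm0 hx (by linarith : -α ≤ 0)
      gcongr
    refine (hausdorffPre_subtree_le (Y := Y m) (y := (m : ℝ) ^ γ) (r := r m) hα hA hs hcon hmn
      (by positivity) (by positivity) (Nat.lt_floor_add_one _).le ?_ (hmono _ hmγ)).trans ?_
    · calc lam m * r m ≤ (m : ℝ) ^ (-α) * r m := by gcongr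
        _ = ((m : ℝ) ^ γ) ^ (-α) := by
          rw [hr]
          dsimp only
          rw [← Real.rpow_add hm0, ← Real.rpow_mul hm0.le]
          ring_nf
    · simp only [hm1, if_true]
      refine add_le_add le_rfl (Finset.sum_le_sum fun n hn => ?_)
      have hmn' := (Finset.mem_Ico.1 hn).1
      by_cases hk : (K n ω : ℕ) = m
      · have h5 : graftInd K n m ω = 1 := Set.indicator_of_mem (s := {ω | (K n ω : ℕ) = m}) hk 1
        rw [h5, one_mul, Set.indicator_of_mem (s := {n : ℕ | (K n ω : ℕ) = m}) hk]
        exact hV ω n₀ hcon (n + 1) (by omega) (by omega) δ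
          (hmono _ (by exact_mod_cast (by omega : m ≤ n + 1)))
      · rw [Set.indicator_of_notMem (s := {n : ℕ | (K n ω : ℕ) = m}) hk]
        exact zero_le

/-- Otherwise the admissible exponents have a supremum at most `1`, while any admissible exponent in
`[α * s, 1)` can be raised by at least `η / c`, a contradiction near the supremum. -/
theorem exists_costBound [IsProbabilityMeasure P] {w : ℕ → ℝ} {τ : Measure (Block u₀)}
    (hglue : IsRandomGluing P τ w B K Z) (hw : ∀ n, 0 ≤ w n) (hw₀ : 0 < w 0)
    {α β d A s : ℝ} (hα : 0 < α) (hβ : 1 < β) (hA : 0 ≤ A) (hs : 0 ≤ s) (hds : d < s)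
    (hαs : α * s < 1)
    (hdisc : (1 - α * d + α * (s - d)) ^ 2 < 4 * (α * (s - d)) * (β - α * d))
    (hlamα : ∀ᶠ n : ℕ in atTop, lam n ≤ (n : ℝ) ^ (-α))
    (hwβ : ∀ᶠ n : ℕ in atTop, w n / w 0 ≤ (n : ℝ) ^ (-β))
    (hball : ∀ᶠ r : ℝ in 𝓝[>] 0,
      ∫⁻ b, ((ballNumber r (b.carrier : Set U) : ℕ∞) : ℝ≥0∞) ∂τ ≤ ENNReal.ofReal (r ^ (-d))) :
    ∃ a, 1 < a ∧ CostBound lam hlam B K Z P α A s a := by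
  by_contra! hcon
  set I : Set ℝ := {a | CostBound lam hlam B K Z P α A s a} with hI
  have hbase : α * s ∈ I := CostBound.of_ball hA hs
  have hub : ∀ a ∈ I, a ≤ 1 := fun a ha => not_lt.1 fun h1 => hcon a h1 ha
  have hbdd : BddAbove I := ⟨1, hub⟩
  set σ := α * (s - d) with hσ
  have hσ0 : 0 < σ := mul_pos hα (sub_pos.2 hds)
  set η := σ * (β - α * d) - (1 - α * d + σ) ^ 2 / 4 with hη
  have hη0 : 0 < η := by rw [hη]; linarith
  have hstar : sSup I ≤ 1 := csSup_le ⟨_, hbase⟩ hub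
  have hle : α * s ≤ sSup I := le_csSup hbdd hbase
  set c := 1 - α * d with hc
  have hc0 : 0 < c := by
    have : α * (s - d) = α * s - α * d := by ring
    linarith
  have hηc : 0 < η / c := div_pos hη0 hc0
  -- The exponent must stay below `1` for the improvement to apply, and above `α * s` so that `v ≤
  -- c`.
  obtain ⟨a, ha, has, ha1, hae⟩ : ∃ a ∈ I, α * s ≤ a ∧ a < 1 ∧ sSup I < a + η / c := by
    rcases lt_or_ge (sSup I - η / c) (α * s) with h1 | h1
    · exact ⟨α * s, hbase, le_rfl, hαs, by linarith⟩
    · obtain ⟨a', ha', hlt⟩ := exists_lt_of_lt_csSup ⟨_, hbase⟩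
        (show sSup I - η / c / 2 < sSup I by linarith)
      exact ⟨_, ha'.mono hlt.le, by linarith, by linarith, by linarith⟩
  set v := σ + 1 - a with hv
  have hv0 : 0 < v := by linarith
  have hvc : v ≤ c := by
    have : α * (s - d) = α * s - α * d := by ring
    linarith
  have hγv : (β - α * d) / v * v = β - α * d := div_mul_cancel₀ _ hv0.ne'
  have hnew := CostBound.improve (γ := (β - α * d) / v) hglue hw hw₀ hα hA hs hlamα hwβ hball
    ((mul_nonneg hα.le hs).trans has) ha1 (by rw [one_lt_div hv0]; linarith) hγv ha
  have h1 := le_csSup hbdd hnew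
  -- Completing the square: the gain is `(v ^ 2 - (c + σ) * v + σ * (β - α * d)) / v`, and `η > 0`
  -- is minus a quarter of the discriminant of its numerator.
  have h2 : α * d + (β - α * d) / v * σ - a =
      η / v + (v - (c + σ) / 2) ^ 2 / v := by
    rw [← add_div, eq_div_iff hv0.ne', hη]
    linear_combination σ * hγv + v * hc - v * hv
  have h3 : η / c ≤ η / v := div_le_div_of_nonneg_left hη0.le hv0 hvc
  have h4 : 0 ≤ (v - (c + σ) / 2) ^ 2 / v := by positivity
  linarith

theorem hausdorffMeasure_eq_zero_of_pre {X : Type*} [MetricSpace X] [MeasurableSpace X]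
    [BorelSpace X] {s : ℝ} {S : Set X} (h : ∀ δ : ℝ≥0∞, 0 < δ → hausdorffPre s δ S = 0) :
    Measure.hausdorffMeasure s S = 0 := by
  have h1 := OuterMeasure.mkMetric'.tendsto_pre (fun S : Set X => Metric.ediam S ^ s) S
  have h2 : Tendsto (fun δ => OuterMeasure.mkMetric'.pre (fun S : Set X => Metric.ediam S ^ s) δ S)
      (𝓝[>] 0) (𝓝 0) := by
    refine tendsto_const_nhds.congr' ?_
    filter_upwards [self_mem_nhdsWithin] with δ hδ using (h δ hδ).symm
  have h3 := tendsto_nhds_unique h1 h2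
  have h4 := congrFun (OuterMeasure.coe_mkMetric (X := X) fun r => r ^ s) S
  exact h4.symm.trans h3

/-- The subtrees of index at least `i + N` cover the leaves, at a cost bounded by the tail of a
convergent series. -/
theorem dimH_leaves_le {α A s : ℝ} (hα : 0 < α) (hs : 0 ≤ s) {b : ℕ → Block u₀}
    {k : ∀ n : ℕ, Fin (n + 1)} {z : ℕ → U} {n₀ N : ℕ} (h : Controlled lam hlam b k z α A n₀)
    {V : ℕ → ℝ≥0∞} (hsum : ∑' n, V (n + N) ≠ ∞)
    (hV : ∀ m, n₀ ≤ m → N ≤ m → ∀ δ : ℝ≥0∞,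
      ENNReal.ofReal (2 * ((1 + A) * (m : ℝ) ^ (-α))) ≤ δ →
        hausdorffPre s δ (closure (subtree lam hlam b k z m)) ≤ V m) :
    dimH (leaves lam hlam b k z) ≤ ENNReal.ofReal s := by
  borelize (Space u₀ lam hlam)
  refine dimH_le_of_hausdorffMeasure_ne_top (d := s.toNNReal) ?_
  rw [Real.coe_toNNReal s hs, hausdorffMeasure_eq_zero_of_pre]
  · exact ENNReal.zero_ne_top
  intro δ hδ
  have hlim : Tendsto (fun m : ℕ => ENNReal.ofReal (2 * ((1 + A) * (m : ℝ) ^ (-α)))) atTop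
      (𝓝 0) := by
    have := (((tendsto_rpow_neg_atTop hα).comp tendsto_natCast_atTop_atTop).const_mul
      (1 + A)).const_mul 2
    simpa using ENNReal.tendsto_ofReal this
  obtain ⟨M, hM⟩ := eventually_atTop.1 (hlim.eventually (gt_mem_nhds hδ))
  refine le_antisymm (ge_of_tendsto (ENNReal.tendsto_sum_nat_add _ hsum) ?_) zero_le
  filter_upwards [eventually_ge_atTop (max n₀ M)] with i hi
  have hi1 : n₀ ≤ i := (le_max_left _ _).trans hi
  have hi2 : M ≤ i := (le_max_right _ _).trans hi
  calc hausdorffPre s δ (leaves lam hlam b k z)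
      ≤ hausdorffPre s δ (⋃ n, closure (subtree lam hlam b k z (n + i + N))) := by
        refine measure_mono ((leaves_subset hα h (N := i + N) (by omega)).trans ?_)
        refine Set.iUnion₂_subset fun m hm => ?_
        obtain ⟨n, rfl⟩ := Nat.exists_eq_add_of_le' hm
        exact Set.subset_iUnion_of_subset n (by rw [add_assoc])
    _ ≤ ∑' n, hausdorffPre s δ (closure (subtree lam hlam b k z (n + i + N))) :=
        measure_iUnion_le _
    _ ≤ ∑' n, V (n + i + N) := ENNReal.tsum_le_tsum fun n =>
        hV _ (by omega) (by omega) δ (hM _ (by omega)).le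

theorem IsRandomGluing.ae_dimH_leaves_le [IsProbabilityMeasure P] [SecondCountableTopology U]
    [BorelSpace U] {w : ℕ → ℝ} {τ : Measure (Block u₀)}
    (hglue : IsRandomGluing P τ w B K Z) (hw : ∀ n, 0 ≤ w n) (hw₀ : 0 < w 0)
    {α β d s ε : ℝ} (hε : 0 < ε) (hα : 0 < α) (hβ : 1 < β) (hs : 0 ≤ s) (hds : d < s)
    (hαs : α * s < 1)
    (hdisc : (1 - α * d + α * (s - d)) ^ 2 < 4 * (α * (s - d)) * (β - α * d))
    (hlamα : ∀ᶠ n : ℕ in atTop, lam n ≤ (n : ℝ) ^ (-α - ε))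
    (hwβ : ∀ᶠ n : ℕ in atTop, w n / w 0 ≤ (n : ℝ) ^ (-β))
    (hdiam : ∀ k : ℕ, ∫⁻ b, ENNReal.ofReal (Metric.diam (b.carrier : Set U) ^ k) ∂τ < ∞)
    (hball : ∀ᶠ r : ℝ in 𝓝[>] 0,
      ∫⁻ b, ((ballNumber r (b.carrier : Set U) : ℕ∞) : ℝ≥0∞) ∂τ ≤ ENNReal.ofReal (r ^ (-d))) :
    ∀ᵐ ω ∂P, dimH (leaves lam hlam (fun n => B n ω) (fun n => K n ω) (fun n => Z n ω)) ≤
      ENNReal.ofReal s := by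
  obtain ⟨l, hl⟩ := exists_nat_gt (1 / (β - 1))
  have hl1 : 1 < (β - 1) * l := by rwa [div_lt_iff₀' (by linarith)] at hl
  have hl0 : 1 ≤ l := by
    rcases Nat.eq_zero_or_pos l with rfl | h
    · norm_num at hl1
    · exact h
  have h2 : (2 : ℝ) ^ (-α) < 1 := Real.rpow_lt_one_of_one_lt_of_neg (by norm_num) (by linarith)
  have hA : (0 : ℝ) ≤ l / (1 - 2 ^ (-α)) := div_nonneg (Nat.cast_nonneg _) (by linarith)
  have hlamα' : ∀ᶠ n : ℕ in atTop, lam n ≤ (n : ℝ) ^ (-α) := by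
    filter_upwards [hlamα, eventually_ge_atTop 1] with n h1 h2
    exact h1.trans (Real.rpow_le_rpow_of_exponent_le (by exact_mod_cast h2) (by linarith))
  obtain ⟨a, ha, V, C, N, -, -, hVm, hVE, hV⟩ := exists_costBound (hlam := hlam) hglue hw hw₀ hα hβ
    hA hs hds hαs hdisc hlamα' hwβ hball
  filter_upwards [hglue.ae_graft_mem, hglue.ae_diam_le hlam hε hlamα hdiam,
    hglue.ae_doubling hw hw₀ hβ hwβ hl1,
    ae_tsum_tail_ne_top (fun n => (hVm n).mono (hglue.future_le n) le_rfl) ha hVE]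
    with ω hZ hD hdesc hsum
  obtain ⟨n₀, hn₀⟩ := eventually_atTop.1 (hD.and (hdesc.and (eventually_ge_atTop 1)))
  have hcon : Controlled lam hlam (fun n => B n ω) (fun n => K n ω) (fun n => Z n ω) α
      (l / (1 - 2 ^ (-α))) n₀ :=
    Controlled.of_doubling hα (hn₀ n₀ le_rfl).2.2 hl0 hZ (fun n hn => (hn₀ n hn).1)
      fun n hn => (hn₀ n hn).2.1
  exact dimH_leaves_le hα hs hcon hsum (hV ω n₀ hcon)

end Cost

/-! ### Absorption of the `o(1)` terms, and the critical exponent. -/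

theorem eventually_le_rpow {u : ℕ → ℝ} {a ε : ℝ} (hε : 0 < ε) (hεa : ε ≤ a)
    (h : ∃ o : ℕ → ℝ, Tendsto o atTop (𝓝 0) ∧
      ∀ᶠ n : ℕ in atTop, u n ≤ ((n : ℝ) + 1) ^ (-a + o n)) :
    ∀ᶠ n : ℕ in atTop, u n ≤ (n : ℝ) ^ (-a + ε) := by
  obtain ⟨o, ho, h⟩ := h
  filter_upwards [h, ho.eventually (gt_mem_nhds hε), eventually_ge_atTop 1] with n h1 h2 h3
  have hn : (1 : ℝ) ≤ n := by exact_mod_cast h3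
  calc u n ≤ ((n : ℝ) + 1) ^ (-a + o n) := h1
    _ ≤ ((n : ℝ) + 1) ^ (-a + ε) :=
        Real.rpow_le_rpow_of_exponent_le (by linarith) (by linarith)
    _ ≤ (n : ℝ) ^ (-a + ε) :=
        Real.rpow_le_rpow_of_nonpos (by linarith) (by linarith) (by linarith)

theorem eventually_div_le_rpow {u : ℕ → ℝ} {a ε c : ℝ} (hε : 0 < ε) (hc : 0 < c)
    (h : ∀ᶠ n : ℕ in atTop, u n ≤ (n : ℝ) ^ (-a + ε)) :
    ∀ᶠ n : ℕ in atTop, u n / c ≤ (n : ℝ) ^ (-(a - 2 * ε)) := by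
  have h1 := ((tendsto_rpow_atTop hε).comp tendsto_natCast_atTop_atTop).eventually_ge_atTop (1 / c)
  filter_upwards [h, h1, eventually_ge_atTop 1] with n h2 h3 h4
  have hn : (0 : ℝ) < n := by exact_mod_cast h4
  have h3' : 1 / c ≤ (n : ℝ) ^ ε := h3
  calc u n / c = u n * (1 / c) := by ring
    _ ≤ (n : ℝ) ^ (-a + ε) * (n : ℝ) ^ ε := by gcongr
    _ = (n : ℝ) ^ (-(a - 2 * ε)) := by rw [← Real.rpow_add hn]; ring_nf

theorem eventually_le_ofReal_rpow {F : ℝ → ℝ≥0∞} {d ε : ℝ} (hε : 0 < ε)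
    (h : ∃ o : ℝ → ℝ, Tendsto o (𝓝[>] 0) (𝓝 0) ∧
      ∀ᶠ r : ℝ in 𝓝[>] 0, F r ≤ ENNReal.ofReal (r ^ (-d + o r))) :
    ∀ᶠ r : ℝ in 𝓝[>] 0, F r ≤ ENNReal.ofReal (r ^ (-(d + ε))) := by
  obtain ⟨o, ho, h⟩ := h
  filter_upwards [h, ho.eventually (lt_mem_nhds (neg_lt_zero.2 hε)),
    Ioo_mem_nhdsGT (zero_lt_one (α := ℝ))] with r h1 h2 h3
  exact h1.trans (ENNReal.ofReal_le_ofReal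
    (Real.rpow_le_rpow_of_exponent_ge h3.1 h3.2.le (by linarith)))

/-- Below `1 / α`, the numbers above the critical dimension make the discriminant of the covering
recursion negative. -/
theorem discriminant_neg {α β d s : ℝ} (hα : 0 < α) (hαd : α * d < 1) (hβ : 1 < β)
    (hs : (2 * β - 1 - 2 * √((β - 1) * (β - α * d))) / α < s) (hs1 : s < 1 / α) :
    d < s ∧ α * s < 1 ∧
      (1 - α * d + α * (s - d)) ^ 2 < 4 * (α * (s - d)) * (β - α * d) := by
  set q := √((β - 1) * (β - α * d)) with hq
  have hq0 : 0 ≤ q := Real.sqrt_nonneg _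
  have hq2 : q ^ 2 = (β - 1) * (β - α * d) :=
    Real.sq_sqrt (mul_nonneg (by linarith) (by linarith))
  rw [div_lt_iff₀' hα] at hs
  rw [lt_div_iff₀' hα] at hs1
  -- The inequality of arithmetic and geometric means: the critical value is at least `d`.
  have h1 : 2 * q ≤ (β - 1) + (β - α * d) := by
    refine abs_le_of_sq_le_sq' ?_ (by linarith) |>.2
    nlinarith [sq_nonneg ((β - 1) - (β - α * d))]
  refine ⟨lt_of_mul_lt_mul_left (by linarith) hα.le, hs1, ?_⟩
  -- The discriminant equals `(2 * β - 1 - α * s) ^ 2 - (2 * q) ^ 2`.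
  have h2 : (2 * β - 1 - α * s) ^ 2 < (2 * q) ^ 2 := by
    refine sq_lt_sq' (by linarith) (by linarith)
  nlinarith

theorem critical_lt {α β d : ℝ} (hα : 0 < α) (hαd : α * d < 1) (hβ : 1 < β) :
    (2 * β - 1 - 2 * √((β - 1) * (β - α * d))) / α < 1 / α := by
  have h : β - 1 < √((β - 1) * (β - α * d)) := by
    refine Real.lt_sqrt_of_sq_lt ?_
    nlinarith
  gcongr
  linarith

end Gluing

end

/-! ### Conclusion. -/

theorem mainTheorem3 {Ω : Type*} [MeasurableSpace Ω] (P : Measure Ω) [IsProbabilityMeasure P]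
    {U : Type*} [MetricSpace U] [CompleteSpace U] [SecondCountableTopology U]
    [MeasurableSpace U] [BorelSpace U] (u₀ : U)
    (lam w : ℕ → ℝ) (hlam : ∀ n, 0 < lam n) (hw : ∀ n, 0 ≤ w n) (hw₀ : 0 < w 0)
    (τ : Measure (Gluing.Block u₀)) [IsProbabilityMeasure τ]
    (B : ℕ → Ω → Gluing.Block u₀) (K : ∀ n : ℕ, Ω → Fin (n + 1)) (Z : ℕ → Ω → U)
    (hglue : Gluing.IsRandomGluing P τ w B K Z)
    (d α β : ℝ) (hd : 0 ≤ d) (hα : 0 < α) (hαd : α * d < 1) (hβ : 1 < β)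
    -- the block and the sequences of index `n` are those of index `n + 1` when counting from `1`
    (hlam_le : ∃ o : ℕ → ℝ, Tendsto o atTop (𝓝 0) ∧
      ∀ᶠ n : ℕ in atTop, lam n ≤ ((n : ℝ) + 1) ^ (-α + o n))
    (hw_le : ∃ o : ℕ → ℝ, Tendsto o atTop (𝓝 0) ∧
      ∀ᶠ n : ℕ in atTop, w n ≤ ((n : ℝ) + 1) ^ (-β + o n))
    (hdiam : ∀ k : ℕ,
      ∫⁻ b, ENNReal.ofReal (Metric.diam (b.carrier : Set U) ^ k) ∂τ < ∞)
    (hball : ∃ o : ℝ → ℝ, Tendsto o (𝓝[>] 0) (𝓝 0) ∧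
      ∀ᶠ r : ℝ in 𝓝[>] 0,
        ∫⁻ b, ((Gluing.ballNumber r (b.carrier : Set U) : ℕ∞) : ℝ≥0∞) ∂τ
          ≤ ENNReal.ofReal (r ^ (-d + o r))) :
    ∀ᵐ ω ∂P, dimH (Gluing.leaves lam hlam (fun n => B n ω) (fun n => K n ω) (fun n => Z n ω)) ≤
      ENNReal.ofReal ((2 * β - 1 - 2 * √((β - 1) * (β - α * d))) / α) := by
  set f := (2 * β - 1 - 2 * √((β - 1) * (β - α * d))) / α with hf
  have key : ∀ s, f < s → s < 1 / α → ∀ᵐ ω ∂P,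
      dimH (Gluing.leaves lam hlam (fun n => B n ω) (fun n => K n ω) (fun n => Z n ω)) ≤
        ENNReal.ofReal s := by
    intro s hfs hs1
    obtain ⟨hds, hαs, hdisc⟩ := Gluing.discriminant_neg hα hαd hβ hfs hs1
    have hlt : ∀ g h : ℝ → ℝ, Continuous g → Continuous h → g 0 < h 0 →
        ∀ᶠ ε in 𝓝[>] (0 : ℝ), g ε < h ε := fun g h hg hh h0 =>
      ((hg.tendsto 0).eventually_lt (hh.tendsto 0) h0).filter_mono nhdsWithin_le_nhds
    -- All conditions are strict and continuous, so they survive replacing `α`, `β`, `d` by `α - 2 *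
    -- ε`, `β - 2 * ε`, `d + ε`. One `ε` absorbs the `o(1)`; the second absorbs the random diameters
    -- for `α` and the constant `w 0` for `β`.
    obtain ⟨ε, hε, h1, h2, h3, h4, h5⟩ := (eventually_mem_nhdsWithin.and
      ((hlt (fun _ => 0) (fun ε => α - 2 * ε) (by fun_prop) (by fun_prop) (by simpa)).and
      ((hlt (fun _ => 1) (fun ε => β - 2 * ε) (by fun_prop) (by fun_prop) (by simpa)).and
      ((hlt (fun ε => d + ε) (fun _ => s) (by fun_prop) (by fun_prop) (by simpa)).and
      ((hlt (fun ε => (α - 2 * ε) * s) (fun _ => 1) (by fun_prop) (by fun_prop) (by simpa)).and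
      (hlt (fun ε => (1 - (α - 2 * ε) * (d + ε) + (α - 2 * ε) * (s - (d + ε))) ^ 2)
        (fun ε => 4 * ((α - 2 * ε) * (s - (d + ε))) * ((β - 2 * ε) - (α - 2 * ε) * (d + ε)))
        (by fun_prop) (by fun_prop) (by simpa))))))).exists
    have hε0 : 0 < ε := hε
    refine hglue.ae_dimH_leaves_le hw hw₀ hε0 h1 h2 (by linarith) h3 h4 h5 ?_
      (Gluing.eventually_div_le_rpow hε0 hw₀
        (Gluing.eventually_le_rpow hε0 (by linarith) hw_le)) hdiam
      (Gluing.eventually_le_ofReal_rpow hε0 hball)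
    convert Gluing.eventually_le_rpow hε0 (by linarith) hlam_le using 4
    ring
  -- A sequence decreasing to the critical value leaves only countably many null sets to discard.
  obtain ⟨u, -, hu, hlim⟩ := exists_seq_strictAnti_tendsto' (Gluing.critical_lt hα hαd hβ)
  filter_upwards [ae_all_iff.2 fun n => key (u n) (hu n).1 (hu n).2] with ω hω
  exact ge_of_tendsto' (ENNReal.tendsto_ofReal hlim) hω
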